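/- Let $M$, $N$ be (smooth, Hausdorff) Riemannian manifolds of the same dimension $n$, and let $\Omega\subset M$, $\Lambda\subset N$ be domains (nonempty connected open sets, not necessarily bounded), with closures $\overline\Omega$, $\overline\Lambda$. Let $c:\Omega\times\Lambda\to\mathbf R$ be a cost function such that: (A0) $c\in C^4_{\rm loc}(\overline\Omega\times\overline\Lambda)$, i.e. $c$ is $C^4$ on $\Omega\times\Lambda$ and its derivatives of order $\le 4$ (in local coordinates) extend continuously to $\overline\Omega\times\overline\Lambda$; below, $c$ and its derivatives at boundary points are these extensions; (A1) for each $x\in\Omega$ the map $y\mapsto-\nabla_xc(x,y)\in T_xM$ is injective on $\overline\Lambda$, and for each $y\in\Lambda$ the map $x\mapsto-\nabla_yc(x,y)\in T_yN$ is injective on $\overline\Omega$; (A2) $\det D^2_{xy}c(x,y)\ne0$ for all $x\in\overline\Omega$, $y\in\overline\Lambda$. For $x\in\Omega$, $S\subset\overline\Lambda$, say that $S$ is *$c$-convex with respect to $x$* if $\{-\nabla_xc(x,y): y\in S\}$ is a convex subset of $T_xM$. Assume that $\Lambda$ is $c$-convex with respect to every $x\in\Omega$, and symmetrically that $\Omega$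 is $c^*$-convex with respect to $\Lambda$, i.e. $\{-\nabla_yc(x,y): x\in\Omega\}\subset T_yN$ is convex for every $y\in\Lambda$. Let $c\text{-Exp}_x(p)=y$ for $p=-\nabla_xc(x,y)$, $y\in\Lambda$, and for $(x,y)\in\Omega\times\Lambda$, $\eta,\xi\in T_xM$, $p=-\nabla_xc(x,y)$, put $$\mathfrak S_c(x,y)(\eta,\xi)=\frac{d^2}{dt^2}\Big|_{t=0}\big[-D^2_{xx}c\big](x,c\text{-Exp}_x(p+t\xi))\,\eta\,\eta ,$$ where $D^2_{xx}$ is the Riemannian Hessian (second derivative in normal coordinates at $x$). Assume moreover (A3W) there is $C_0\ge0$ with $\mathfrak S_c(x,y)(\eta,\xi)\ge C_0|\eta|^2|\xi|^2$ for all $(x,y)\in\Omega\times\Lambda$ and all $\eta\perp\xi$ in $T_xM$. Let $\phi$ be a *$c$-convex function on $\Omega$ indexed by $\Lambda$*: there is $v:\overline\Lambda\to\mathbf R\cup\{+\infty\}$ such that for each $x\in\Omega$ $$\phi(x)=\sup_{y\in\Lambda}\big(-c(x,y)-v(y)\big)=\sup_{y\in\overline\Lambda}\big(-c(x,y)-v(y)\big)$$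 and $\phi(x)+v(y)=-c(x,y)$ for some $y\in\overline\Lambda$. For $x\in\Omega$ let $$G_\phi(x)=\Big\{y\in\overline\Lambda:\ \phi(x)+\sup_{z\in\Omega}\big(-c(z,y)-\phi(z)\big)=-c(x,y)\Big\}$$ be its contact set at $x$. Then for every $x\in\Omega$ the contact set $G_\phi(x)$ is $c$-convex with respect to $x$, and $G_\phi(x)$ is (nonempty and) connected, where, in case $G_\phi(x)\not\subset\Lambda$, it is also assumed that $\overline\Lambda$ is $c$-convex with respect to $x$ (which is automatic if $\overline\Lambda$ is compact). -/

import Mathlib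

open Set Filter Topology
open scoped Manifold ContDiff

noncomputable section

/-- The model space `ℝⁿ`. -/
abbrev Eu (n : ℕ) : Type := EuclideanSpace ℝ (Fin n)

/-- A smooth Riemannian metric on the (boundaryless) smooth `n`-manifold `M`. -/
abbrev RiemMetric (n : ℕ) (M : Type*) [TopologicalSpace M] [ChartedSpace (Eu n) M]
    [IsManifold 𝓘(ℝ, Eu n) ∞ M] :=
  Bundle.ContMDiffRiemannianMetric 𝓘(ℝ, Eu n) ∞ (Eu n)
    (fun x : M => TangentSpace 𝓘(ℝ, Eu n) x)

section OneManifold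

variable {n : ℕ} {M : Type*} [TopologicalSpace M] [ChartedSpace (Eu n) M]
  [IsManifold 𝓘(ℝ, Eu n) ∞ M]

/-- The Riemannian gradient `∇f(x) ∈ T_xM`: the inverse of `v ↦ g_x(v, ·)` applied to the
differential of `f` at `x`. -/
def riemGrad (g : RiemMetric n M) (f : M → ℝ) (x : M) : TangentSpace 𝓘(ℝ, Eu n) x :=
  ContinuousLinearMap.inverse (g.inner x) (mfderiv 𝓘(ℝ, Eu n) 𝓘(ℝ, ℝ) f x)

/-- The defining property of the gradient, `g_x(∇f(x), w) = df_x(w)`. -/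
theorem inner_riemGrad (g : RiemMetric n M) (f : M → ℝ) (x : M)
    (w : TangentSpace 𝓘(ℝ, Eu n) x) :
    g.inner x (riemGrad g f x) w = mfderiv 𝓘(ℝ, Eu n) 𝓘(ℝ, ℝ) f x w := by
  have key : ∀ (B : Eu n →L[ℝ] Eu n →L[ℝ] ℝ), (∀ v, v ≠ 0 → 0 < B v v) →
      ∀ (L : Eu n →L[ℝ] ℝ) (w : Eu n), B (ContinuousLinearMap.inverse B L) w = L w := by
    intro B hB L w
    have hinj : Function.Injective B.toLinearMap := by
      rw [← LinearMap.ker_eq_bot, LinearMap.ker_eq_bot']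
      intro v hv
      by_contra h
      have h1 := hB v h
      have h2 : B v = 0 := hv
      rw [h2] at h1
      simp at h1
    have hdim : Module.finrank ℝ (Eu n) = Module.finrank ℝ (Eu n →L[ℝ] ℝ) := by
      rw [← (LinearMap.toContinuousLinearMap (𝕜 := ℝ) (E := Eu n) (F' := ℝ)).finrank_eq]
      exact Subspace.dual_finrank_eq.symm
    let e := (LinearEquiv.ofInjectiveOfFinrankEq B.toLinearMap hinj hdim).toContinuousLinearEquiv
    have he : B = (e : Eu n →L[ℝ] Eu n →L[ℝ] ℝ) := by
      ext v : 1
      rfl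
    rw [he, ContinuousLinearMap.inverse_equiv]
    simp
  exact key (g.inner x) (g.pos x) (mfderiv 𝓘(ℝ, Eu n) 𝓘(ℝ, ℝ) f x) w

/-- The coefficients of the metric in the chart of `M` centred at `x₀`: at the coordinate point `u`
it is the bilinear form `(a, b) ↦ g(∂_a, ∂_b)`. -/
def metricInChart (g : RiemMetric n M) (x₀ : M) (u a b : Eu n) : ℝ :=
  g.inner ((extChartAt 𝓘(ℝ, Eu n) x₀).symm u)
    (mfderiv 𝓘(ℝ, Eu n) 𝓘(ℝ, Eu n) (extChartAt 𝓘(ℝ, Eu n) x₀).symm u a)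
    (mfderiv 𝓘(ℝ, Eu n) 𝓘(ℝ, Eu n) (extChartAt 𝓘(ℝ, Eu n) x₀).symm u b)

/-- The directional derivative `(∂_w g)(a, b)` at `x`, in the chart of `M` centred at `x`. -/
def metricDeriv (g : RiemMetric n M) (x : M) (w a b : Eu n) : ℝ :=
  fderiv ℝ (fun u => metricInChart g x u a b) (extChartAt 𝓘(ℝ, Eu n) x x) w

/-- The Riemannian Hessian of `f` at `x`, on `η, ζ ∈ T_xM`; equivalently, the second derivative of
`f` in Riemannian normal coordinates at `x`.  In the chart centred at `x` (whose coordinates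
are the ones that identify `T_xM` with `ℝⁿ`) it is `∂_η ∂_ζ f - df(Γ(η, ζ))`, where the Christoffel
symbol `Γ` is given by `2 g(Γ(η, ζ), w) = (∂_η g)(ζ, w) + (∂_ζ g)(η, w) - (∂_w g)(η, ζ)`, and
`df(Γ(η, ζ)) = g(Γ(η, ζ), ∇f)`. -/
def riemHess (g : RiemMetric n M) (f : M → ℝ) (x : M) (η ζ : TangentSpace 𝓘(ℝ, Eu n) x) : ℝ :=
  fderiv ℝ (fderiv ℝ (fun u : Eu n => f ((extChartAt 𝓘(ℝ, Eu n) x).symm u)))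
      (extChartAt 𝓘(ℝ, Eu n) x x) η ζ
    - (metricDeriv g x η ζ (riemGrad g f x) + metricDeriv g x ζ η (riemGrad g f x)
        - metricDeriv g x (riemGrad g f x) η ζ) / 2

end OneManifold

section Cost

variable {n : ℕ} {M N : Type*}
  [TopologicalSpace M] [ChartedSpace (Eu n) M] [IsManifold 𝓘(ℝ, Eu n) ∞ M]
  [TopologicalSpace N] [ChartedSpace (Eu n) N] [IsManifold 𝓘(ℝ, Eu n) ∞ N]

/-- The cost read in the chart of `M` centred at `x₀` and the chart of `N` centred at `y₀`. -/
def costInCharts (c : M → N → ℝ) (x₀ : M) (y₀ : N) (p : Eu n × Eu n) : ℝ :=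
  c ((extChartAt 𝓘(ℝ, Eu n) x₀).symm p.1) ((extChartAt 𝓘(ℝ, Eu n) y₀).symm p.2)

/-- **A0**: `c ∈ C⁴_loc(Ω̄ × Λ̄)`.  The cost is `C⁴` on `Ω × Λ`, and its derivatives of order at
most `4` (in local coordinates) extend continuously to `Ω̄ × Λ̄`; the values of `c` on `Ω̄ × Λ̄` are
those of its continuous extension. -/
structure CostA0 (c : M → N → ℝ) (Ω : Set M) (Λ : Set N) : Prop where
  contMDiffOn : ContMDiffOn (𝓘(ℝ, Eu n).prod 𝓘(ℝ, Eu n)) 𝓘(ℝ, ℝ) 4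
    (fun p : M × N => c p.1 p.2) (Ω ×ˢ Λ)
  tendsto : ∀ x₀ ∈ closure Ω, ∀ y₀ ∈ closure Λ,
    Tendsto (fun p : M × N => c p.1 p.2) (𝓝[Ω ×ˢ Λ] (x₀, y₀)) (𝓝 (c x₀ y₀))
  tendsto_deriv : ∀ x₀ ∈ closure Ω, ∀ y₀ ∈ closure Λ, ∀ k : ℕ, k ≤ 4 →
    ∃ L, Tendsto
      (fun p : M × N => iteratedFDeriv ℝ k (costInCharts (n := n) c x₀ y₀)
        (extChartAt 𝓘(ℝ, Eu n) x₀ p.1, extChartAt 𝓘(ℝ, Eu n) y₀ p.2))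
      (𝓝[Ω ×ˢ Λ] (x₀, y₀)) (𝓝 L)

/-- The vector `-∇ₓc(x, y) ∈ T_xM`. -/
def negGrad (g : RiemMetric n M) (c : M → N → ℝ) (x : M) (y : N) :
    TangentSpace 𝓘(ℝ, Eu n) x :=
  -riemGrad g (fun z => c z y) x

/-- **A1**: `y ↦ -∇ₓc(x, y)` is injective on `Λ̄` for each `x ∈ Ω`, and `x ↦ -∇_y c(x, y)` is
injective on `Ω̄` for each `y ∈ Λ`. -/
def CostA1 (g : RiemMetric n M) (h : RiemMetric n N) (c : M → N → ℝ) (Ω : Set M) (Λ : Set N) :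
    Prop :=
  (∀ x ∈ Ω, InjOn (fun y => negGrad g c x y) (closure Λ)) ∧
  (∀ y ∈ Λ, InjOn (fun x => negGrad h (fun y x => c x y) y x) (closure Ω))

/-- The matrix of mixed second partial derivatives `∂²c / ∂xᵢ∂yⱼ` at `(x, y)`, in the charts
centred at `x₀` and `y₀`. -/
def mixedHess (c : M → N → ℝ) (x₀ : M) (y₀ : N) (x : M) (y : N) : Matrix (Fin n) (Fin n) ℝ :=
  Matrix.of fun i j =>
    fderiv ℝ
      (fun w : Eu n =>
        fderiv ℝ (fun u : Eu n => costInCharts c x₀ y₀ (u, w)) (extChartAt 𝓘(ℝ, Eu n) x₀ x)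
          (EuclideanSpace.single i 1))
      (extChartAt 𝓘(ℝ, Eu n) y₀ y) (EuclideanSpace.single j 1)

/-- **A2**: `det D²_{xy} c ≠ 0` on `Ω̄ × Λ̄`, where at boundary points `D²_{xy} c` means the
continuous extension. -/
def CostA2 (c : M → N → ℝ) (Ω : Set M) (Λ : Set N) : Prop :=
  ∀ x₀ ∈ closure Ω, ∀ y₀ ∈ closure Λ, ∃ A : Matrix (Fin n) (Fin n) ℝ, A.det ≠ 0 ∧
    Tendsto (fun p : M × N => mixedHess (n := n) c x₀ y₀ p.1 p.2) (𝓝[Ω ×ˢ Λ] (x₀, y₀)) (𝓝 A)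

/-- The `c`-exponential map on its domain `{-∇ₓc(x, y) | y ∈ Λ}`: `c-Exp_x p` is the `y ∈ Λ` with
`p = -∇ₓc(x, y)`.  The point `y₀` only serves to give the map a value off this domain. -/
def cExp (g : RiemMetric n M) (c : M → N → ℝ) (Λ : Set N) (y₀ : N) (x : M)
    (p : TangentSpace 𝓘(ℝ, Eu n) x) : N :=
  haveI : Nonempty N := ⟨y₀⟩
  Function.invFunOn (fun y => negGrad g c x y) Λ p

/-- The `c`-sectional curvature
`𝔖_c(x, y)(η, ξ) = d²/dt²|₀ [-D²ₓₓ c](x, c-Exp_x(p + tξ)) η η`, with `p = -∇ₓc(x, y)`. -/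
def cSectional (g : RiemMetric n M) (c : M → N → ℝ) (Λ : Set N) (x : M) (y : N)
    (η ξ : TangentSpace 𝓘(ℝ, Eu n) x) : ℝ :=
  iteratedDeriv 2
    (fun t : ℝ => -riemHess g (fun z => c z (cExp g c Λ y x (negGrad g c x y + t • ξ))) x η η) 0

/-- **A3W**. -/
def CostA3W (g : RiemMetric n M) (c : M → N → ℝ) (Ω : Set M) (Λ : Set N) : Prop :=
  ∃ C₀ : ℝ, 0 ≤ C₀ ∧ ∀ x ∈ Ω, ∀ y ∈ Λ, ∀ η ξ : TangentSpace 𝓘(ℝ, Eu n) x,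
    g.inner x η ξ = 0 → C₀ * g.inner x η η * g.inner x ξ ξ ≤ cSectional g c Λ x y η ξ

/-- The set `S` is `c`-convex with respect to `x`: its inverse image under `c-Exp_x`, that is
`{-∇ₓc(x, y) | y ∈ S}`, is a convex subset of `T_xM`. -/
def IsCConvexAt (g : RiemMetric n M) (c : M → N → ℝ) (S : Set N) (x : M) : Prop :=
  Convex ℝ ((fun y => negGrad g c x y) '' S)

end Cost

section CConvexFunctions

variable {X Y : Type*}

/-- The `c`-Legendre transformation `L^c v (x) = sup_{y ∈ S} (-c(x, y) - v(y))`. -/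
def cLegendre (c : X → Y → ℝ) (S : Set Y) (v : Y → EReal) (x : X) : EReal :=
  ⨆ y ∈ S, ((-c x y : ℝ) : EReal) - v y

/-- `φ` is a `c`-convex function on `Ω` indexed by `Λ`: `φ = L^c v` for a function
`v : Λ → ℝ ∪ {+∞}`, and the supremum is attained in `Λ̄` at each `x ∈ Ω`.  For the latter to make
sense `v` has values on `Λ̄`, and those at the boundary are such that the supremum does not change
when it is taken over `Λ̄`.  Attainment forces `φ` to be finite. -/
def IsCConvexFunction [TopologicalSpace Y] (c : X → Y → ℝ) (Ω : Set X) (Λ : Set Y) (φ : X → ℝ) :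
    Prop :=
  ∃ v : Y → EReal, (∀ y ∈ closure Λ, v y ≠ ⊥) ∧
    (∀ x ∈ Ω, (φ x : EReal) = cLegendre c Λ v x) ∧
    (∀ x ∈ Ω, (φ x : EReal) = cLegendre c (closure Λ) v x) ∧
    (∀ x ∈ Ω, ∃ y ∈ closure Λ, (φ x : EReal) + v y = ((-c x y : ℝ) : EReal))

/-- The contact set `G_φ(x) = {y ∈ Λ̄ | φ(x) + L^{c*}φ(y) = -c(x, y)}`. -/
def contactSet [TopologicalSpace Y] (c : X → Y → ℝ) (Ω : Set X) (Λ : Set Y) (φ : X → ℝ) (x : X) :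
    Set Y :=
  {y ∈ closure Λ |
    (φ x : EReal) + cLegendre (fun y x => c x y) Ω (fun z => (φ z : EReal)) y
      = ((-c x y : ℝ) : EReal)}

end CConvexFunctions

end

/-! A point `y ∈ Λ̄` is in the contact set at `x` exactly when `c(x,y) - c(z,y) ≤ φ(z) - φ(x)` for
all `z ∈ Ω` (`mem_contactSet_iff`). In the coordinate `p = ∂ₓc(x,y)` the contact set is therefore an
intersection of sublevel sets, and it is convex as soon as every difference `c(x,·) - c(z,·)` is
quasiconvex in `p`. This is Loeper's maximum principle, `RegularCost.quasiconvexOn_sub`.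

By A1 such a difference has no critical point if `z ≠ x`, so it suffices that its Hessian is
nonnegative on the kernel of its differential (`quasiconvexOn_of_hessian_nonneg`). Take a
`c`-segment `y_t` through `y = y_0` in a direction of that kernel, and join `x` to `z` by the
`c*`-segment `X(s)` with respect to `y`, which stays in `Ω` by `c*`-convexity. Put `T(s) = -d²/dt²
c(X(s), y_t)` at `t = 0`. Then `T'(0) = 0`, because `∂ₓc(x, y_t)` is affine in `t`. Moreover `T'' ≥
0`: the fourth order cross derivative can be taken in either order (`cross_deriv_symm`), so A3W, a
concavity of `∂²c/∂x²` along `c`-segments, becomes a concavity of `∂²c/∂y²` along `c*`-segments.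
Convexity gives `T(1) ≥ T(0)`, the required sign (`RegularCost.deriv_deriv_le_of_crossConcaveAt`).

The metric enters only mildly. Lowering indices replaces gradients by differentials, and the
Christoffel term of the Riemannian Hessian is linear in `∇c`, hence affine along a `c`-segment and
invisible to `d²/dt²` (`crossConcaveAt_of_A3W`).

At the boundary of `Λ`, quasiconvexity passes to the closure by density. This needs `p` to be
continuous on `Λ̄` (`tendsto_covec`) with continuous inverse (`comap_covec_inf_le_nhds`). As `Λ̄`
need not be compact, the latter is drawn from A2 and the convexity of the image of `Λ`.
Connectedness follows: the contact set is a continuous image of a convex set. -/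

open Set Filter Topology
open scoped Manifold ContDiff
set_option linter.unusedSectionVars false

/-! ### Calculus of iterated directional derivatives. -/

section DirectionalDerivatives

variable {V : Type*} [NormedAddCommGroup V] [NormedSpace ℝ V]

/-- The derivative of `F` in the direction `v`, as a function of the point. -/
noncomputable def dd (v : V) (F : V → ℝ) : V → ℝ := fun p => fderiv ℝ F p v

theorem dd_apply (v : V) (F : V → ℝ) (p : V) : dd v F p = fderiv ℝ F p v := rfl

theorem dd_contDiffAt {F : V → ℝ} {p : V} {k m : ℕ} (hF : ContDiffAt ℝ k F p)
    (hm : m + 1 ≤ k) (v : V) : ContDiffAt ℝ m (dd v F) p := by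
  have h : ContDiffAt ℝ m (fderiv ℝ F) p :=
    hF.fderiv_right (by exact_mod_cast hm)
  exact h.clm_apply contDiffAt_const

theorem dd_congr {F G : V → ℝ} {p : V} (h : F =ᶠ[𝓝 p] G) (v : V) : dd v F =ᶠ[𝓝 p] dd v G := by
  filter_upwards [h.fderiv (𝕜 := ℝ)] with q hq
  rw [dd_apply, dd_apply, hq]

theorem eventually_contDiffAt {W : Type*} [NormedAddCommGroup W] [NormedSpace ℝ W]
    {F : V → W} {p : V} {k : ℕ} (hF : ContDiffAt ℝ k F p) :
    ∀ᶠ q in 𝓝 p, ContDiffAt ℝ k F q :=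
  hF.eventually (by simp)

theorem dd_dd_apply {F : V → ℝ} {p : V} (hF : ContDiffAt ℝ 2 F p) (v w : V) :
    dd v (dd w F) p = fderiv ℝ (fderiv ℝ F) p v w := by
  have h : DifferentiableAt ℝ (fderiv ℝ F) p :=
    (hF.fderiv_right (m := 1) (by norm_num)).differentiableAt (by norm_num)
  change fderiv ℝ (fun q => fderiv ℝ F q w) p v = _
  rw [fderiv_clm_apply h (differentiableAt_const w)]
  simp

theorem dd_comm {F : V → ℝ} {p : V} (hF : ContDiffAt ℝ 2 F p) (v w : V) :
    dd v (dd w F) p = dd w (dd v F) p := by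
  rw [dd_dd_apply hF, dd_dd_apply hF]
  exact (hF.isSymmSndFDerivAt (by simp)).eq v w

theorem dd_comm_eventually {F : V → ℝ} {p : V} {k : ℕ} (hF : ContDiffAt ℝ k F p) (hk : 2 ≤ k)
    (v w : V) : dd v (dd w F) =ᶠ[𝓝 p] dd w (dd v F) := by
  filter_upwards [eventually_contDiffAt hF] with q hq
  exact dd_comm (hq.of_le (by exact_mod_cast hk)) v w

/-- Second derivative of a function along a curve. -/
theorem deriv_deriv_comp {F : V → ℝ} {γ : ℝ → V} {t : ℝ} (hF : ContDiffAt ℝ 2 F (γ t))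
    (hγ : ContDiffAt ℝ 2 γ t) :
    deriv (deriv (fun r => F (γ r))) t =
      dd (deriv γ t) (dd (deriv γ t) F) (γ t) + dd (deriv (deriv γ) t) F (γ t) := by
  have h1 : deriv (fun r => F (γ r)) =ᶠ[𝓝 t] fun r => fderiv ℝ F (γ r) (deriv γ r) := by
    filter_upwards [hγ.continuousAt.eventually (eventually_contDiffAt (k := 2) hF),
      eventually_contDiffAt (k := 2) hγ] with r h1 h2
    exact fderiv_comp_deriv r (h1.differentiableAt (by norm_num))
      (h2.differentiableAt (by norm_num))
  rw [h1.deriv_eq]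
  have hF' : DifferentiableAt ℝ (fderiv ℝ F) (γ t) :=
    (hF.fderiv_right (m := 1) (by norm_num)).differentiableAt (by norm_num)
  have hg : DifferentiableAt ℝ γ t := hγ.differentiableAt (by norm_num)
  have hg' : DifferentiableAt ℝ (deriv γ) t :=
    (((hγ.fderiv_right (m := 1) (by norm_num)).clm_apply (contDiffAt_const (c := (1 : ℝ)))).differentiableAt (by norm_num))
  have h2 : HasDerivAt (fun r => fderiv ℝ F (γ r)) (fderiv ℝ (fderiv ℝ F) (γ t) (deriv γ t)) t :=
    hF'.hasFDerivAt.comp_hasDerivAt t hg.hasDerivAt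
  have h3 := (h2.clm_apply hg'.hasDerivAt).deriv
  rw [h3, dd_dd_apply hF, dd_apply]

end DirectionalDerivatives

/-! ### Exchange of the two segments in the fourth order cross derivative. -/

section Crossing

variable {E₁ E₂ : Type*} [NormedAddCommGroup E₁] [NormedSpace ℝ E₁]
  [NormedAddCommGroup E₂] [NormedSpace ℝ E₂]

theorem deriv_prodMk_left {ρ : ℝ → E₂} {t : ℝ} (u : E₁) (hρ : DifferentiableAt ℝ ρ t) :
    deriv (fun r => (u, ρ r)) t = (0, deriv ρ t) :=
  ((hasDerivAt_const t u).prodMk hρ.hasDerivAt).deriv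

theorem deriv_prodMk_right {υ : ℝ → E₁} {t : ℝ} (w : E₂) (hυ : DifferentiableAt ℝ υ t) :
    deriv (fun r => (υ r, w)) t = (deriv υ t, 0) :=
  (hυ.hasDerivAt.prodMk (hasDerivAt_const t w)).deriv

theorem eventually_differentiableAt {V : Type*} [NormedAddCommGroup V] [NormedSpace ℝ V]
    {γ : ℝ → V} {t : ℝ} (h : ContDiffAt ℝ 2 γ t) : ∀ᶠ r in 𝓝 t, DifferentiableAt ℝ γ r := by
  filter_upwards [eventually_contDiffAt (k := 2) h] with r hr using hr.differentiableAt (by norm_num)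

theorem contDiffAt_deriv {V : Type*} [NormedAddCommGroup V] [NormedSpace ℝ V]
    {γ : ℝ → V} {t : ℝ} (h : ContDiffAt ℝ 2 γ t) : DifferentiableAt ℝ (deriv γ) t := by
  have := h.fderiv_right (m := 1) (by norm_num)
  exact (this.clm_apply (contDiffAt_const (c := (1 : ℝ)))).differentiableAt (by norm_num)

theorem deriv_deriv_prodMk_left {ρ : ℝ → E₂} {t : ℝ} (u : E₁) (hρ : ContDiffAt ℝ 2 ρ t) :
    deriv (deriv (fun r => (u, ρ r))) t = (0, deriv (deriv ρ) t) := by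
  have h : deriv (fun r => (u, ρ r)) =ᶠ[𝓝 t] fun r => ((0 : E₁), deriv ρ r) := by
    filter_upwards [eventually_differentiableAt hρ] with r hr using deriv_prodMk_left u hr
  rw [h.deriv_eq, deriv_prodMk_left 0 (contDiffAt_deriv hρ)]

theorem deriv_deriv_prodMk_right {υ : ℝ → E₁} {t : ℝ} (w : E₂) (hυ : ContDiffAt ℝ 2 υ t) :
    deriv (deriv (fun r => (υ r, w))) t = (deriv (deriv υ) t, 0) := by
  have h : deriv (fun r => (υ r, w)) =ᶠ[𝓝 t] fun r => (deriv υ r, (0 : E₂)) := by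
    filter_upwards [eventually_differentiableAt hυ] with r hr using deriv_prodMk_right w hr
  rw [h.deriv_eq, deriv_prodMk_right 0 (contDiffAt_deriv hυ)]

theorem deriv_deriv_comp_left {F : E₁ × E₂ → ℝ} {ρ : ℝ → E₂} {u : E₁} {t : ℝ}
    (hF : ContDiffAt ℝ 2 F (u, ρ t)) (hρ : ContDiffAt ℝ 2 ρ t) :
    deriv (deriv (fun r => F (u, ρ r))) t =
      dd (0, deriv ρ t) (dd (0, deriv ρ t) F) (u, ρ t)
        + dd (0, deriv (deriv ρ) t) F (u, ρ t) := by
  have h := deriv_deriv_comp (γ := fun r => (u, ρ r)) hF (contDiffAt_const.prodMk hρ)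
  rw [deriv_deriv_prodMk_left u hρ,
    deriv_prodMk_left u (hρ.differentiableAt (by norm_num))] at h
  exact h

theorem deriv_deriv_comp_right {F : E₁ × E₂ → ℝ} {υ : ℝ → E₁} {w : E₂} {t : ℝ}
    (hF : ContDiffAt ℝ 2 F (υ t, w)) (hυ : ContDiffAt ℝ 2 υ t) :
    deriv (deriv (fun r => F (υ r, w))) t =
      dd (deriv υ t, 0) (dd (deriv υ t, 0) F) (υ t, w)
        + dd (deriv (deriv υ) t, 0) F (υ t, w) := by
  have h := deriv_deriv_comp (γ := fun r => (υ r, w)) hF (hυ.prodMk contDiffAt_const)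
  rw [deriv_deriv_prodMk_right w hυ,
    deriv_prodMk_right w (hυ.differentiableAt (by norm_num))] at h
  exact h

theorem deriv_deriv_of_eventually_affine {f : ℝ → ℝ} {t a b : ℝ}
    (h : ∀ᶠ r in 𝓝 t, f r = a + r * b) : deriv (deriv f) t = 0 := by
  have h1 : deriv f =ᶠ[𝓝 t] fun _ => b := by
    filter_upwards [h.eventually_nhds] with r hr
    rw [EventuallyEq.deriv_eq (f := fun r => a + r * b) hr]
    simp
  rw [h1.deriv_eq]
  simp

/-- Symmetry of the fourth order cross derivative along a pair of segments. -/
theorem cross_deriv_symm {C : E₁ × E₂ → ℝ} {υ : ℝ → E₁} {ρ : ℝ → E₂} {s t : ℝ}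
    (hC : ContDiffAt ℝ 4 C (υ s, ρ t)) (hυ : ContDiffAt ℝ 2 υ s) (hρ : ContDiffAt ℝ 2 ρ t)
    {A B : E₁ → ℝ} (hA : ∀ v, ∀ᶠ r in 𝓝 t, dd (v, 0) C (υ s, ρ r) = A v + r * B v)
    {A' B' : E₂ → ℝ} (hA' : ∀ v, ∀ᶠ r in 𝓝 s, dd (0, v) C (υ r, ρ t) = A' v + r * B' v) :
    deriv (deriv (fun r => dd (deriv υ s, 0) (dd (deriv υ s, 0) C) (υ s, ρ r))) t =
      deriv (deriv (fun r => dd (0, deriv ρ t) (dd (0, deriv ρ t) C) (υ r, ρ t))) s := by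
  have h3 : ∀ v, ContDiffAt ℝ 3 (dd v C) (υ s, ρ t) :=
    fun v => dd_contDiffAt (k := 4) (m := 3) hC (by norm_num) v
  have h2 : ∀ v w, ContDiffAt ℝ 2 (dd v (dd w C)) (υ s, ρ t) :=
    fun v w => dd_contDiffAt (k := 3) (m := 2) (h3 w) (by norm_num) v
  have h32 : ∀ v, ContDiffAt ℝ 2 (dd v C) (υ s, ρ t) := fun v => (h3 v).of_le (by norm_num)
  have hC2 : ContDiffAt ℝ 2 C (υ s, ρ t) := hC.of_le (by norm_num)
  rw [deriv_deriv_comp_left (h2 _ _) hρ, deriv_deriv_comp_right (h2 _ _) hυ]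
  -- The chain rule leaves the acceleration term `∂_{ρ''}∂_{υ'}∂_{υ'}C` on the left and
  -- `∂_{υ''}∂_{ρ'}∂_{ρ'}C` on the right. Affinity of the first partials, tested on `υ''` and on
  -- `ρ''`, shows that both equal `-∂_{υ''}∂_{ρ''}C`.
  have e1 := deriv_deriv_of_eventually_affine (hA (deriv (deriv υ) s))
  rw [deriv_deriv_comp_left (h32 _) hρ] at e1
  have e2 := deriv_deriv_of_eventually_affine (hA' (deriv (deriv ρ) t))
  rw [deriv_deriv_comp_right (h32 _) hυ] at e2
  generalize deriv (deriv υ) s = u2 at *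
  generalize deriv (deriv ρ) t = w2 at *
  set a : E₁ × E₂ := (deriv υ s, 0)
  set b : E₁ × E₂ := (0, deriv ρ t)
  have c1 := dd_comm_eventually (k := 4) hC (by norm_num)
  -- moving one direction past two others
  have move : ∀ v w, dd v (dd w (dd w C)) (υ s, ρ t) = dd w (dd w (dd v C)) (υ s, ρ t) := by
    intro v w
    rw [dd_comm (h32 w) v w]
    exact (dd_congr (c1 v w) w).eq_of_nhds
  have moveE : dd b (dd a (dd a C)) =ᶠ[𝓝 (υ s, ρ t)] dd a (dd a (dd b C)) := by
    refine (dd_comm_eventually (k := 3) (h3 a) (by norm_num) b a).trans ?_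
    exact dd_congr (c1 b a) a
  have four : dd b (dd b (dd a (dd a C))) (υ s, ρ t) = dd a (dd a (dd b (dd b C))) (υ s, ρ t) := by
    rw [(dd_congr moveE b).eq_of_nhds, dd_comm (dd_contDiffAt (k := 3) (m := 2) (h3 b) (by norm_num) a),
      (dd_congr (dd_comm_eventually (k := 3) (h3 b) (by norm_num) b a) a).eq_of_nhds]
  rw [four, move, move]
  have := dd_comm hC2 (0, w2) (u2, 0)
  linarith

end Crossing

/-! ### A second order criterion for quasiconvexity. -/

section Quasiconvexity

/-- A function starting at zero and satisfying `u' ≥ -K|u|` stays nonnegative. -/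
theorem nonneg_of_deriv_ge_neg_abs {u u' : ℝ → ℝ} {a b K : ℝ}
    (hu : ∀ t ∈ Icc a b, HasDerivAt u (u' t) t) (ha : u a = 0)
    (h : ∀ t ∈ Icc a b, -(K * |u t|) ≤ u' t) : ∀ t ∈ Icc a b, 0 ≤ u t := by
  intro t ht
  -- Barrier argument for `-u`. The rate `K + 1` instead of `K` makes the comparison strict where
  -- `-u` touches the barrier.
  have key : ∀ ε > 0, -u t ≤ ε * Real.exp ((K + 1) * (t - a)) := by
    intro ε hε
    refine image_le_of_deriv_right_lt_deriv_boundary (f := fun t => -u t) (f' := fun t => -u' t)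
      (B := fun t => ε * Real.exp ((K + 1) * (t - a)))
      (B' := fun t => ε * (Real.exp ((K + 1) * (t - a)) * ((K + 1) * 1)))
      (fun r hr => (hu r hr).neg.continuousAt.continuousWithinAt)
      (fun r hr => (hu r (Ico_subset_Icc_self hr)).neg.hasDerivWithinAt)
      (by simp [ha, hε.le])
      (fun r => ((((hasDerivAt_id r).sub_const a).const_mul (K + 1)).exp).const_mul ε) ?_ ht
    intro r hr hrB
    have h1 := h r (Ico_subset_Icc_self hr)
    have hpos : 0 < ε * Real.exp ((K + 1) * (r - a)) := by positivity
    have h2 : |u r| = ε * Real.exp ((K + 1) * (r - a)) := by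
      rw [← hrB, abs_of_neg]
      linarith
    rw [h2] at h1
    nlinarith
  by_contra hneg
  push Not at hneg
  have hpos : 0 < Real.exp ((K + 1) * (t - a)) := Real.exp_pos _
  have := key (-u t / 2 / Real.exp ((K + 1) * (t - a))) (div_pos (by linarith) hpos)
  rw [div_mul_cancel₀ _ hpos.ne'] at this
  linarith

variable {V : Type*} [NormedAddCommGroup V] [NormedSpace ℝ V]

/-- With `v` such that `q t₀ v ≠ 0`, split `ξ = η + μ v` where `η ∈ ker (q t)` and `μ = q t ξ / q t
v`. Then `H(ξ,ξ) - H(η,η)` is `q t ξ` times a factor continuous at `t₀`, hence bounded near it.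
Along a segment this yields the differential inequality `f'' ≥ -K|f'|`. -/
theorem exists_hessian_lower_bound {q : ℝ → V →L[ℝ] ℝ} {H : ℝ → V →L[ℝ] V →L[ℝ] ℝ} {t₀ : ℝ}
    {ξ : V} (hq : ContinuousAt q t₀) (hH : ContinuousAt H t₀) (hq0 : q t₀ ≠ 0)
    (h : ∀ᶠ t in 𝓝 t₀, ∀ η, q t η = 0 → 0 ≤ H t η η) :
    ∃ K : ℝ, ∀ᶠ t in 𝓝 t₀, -(K * |q t ξ|) ≤ H t ξ ξ := by
  obtain ⟨v, hv⟩ : ∃ v, q t₀ v ≠ 0 := by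
    by_contra hcon
    push Not at hcon
    exact hq0 (ContinuousLinearMap.ext hcon)
  have cq : ∀ w, ContinuousAt (fun t => q t w) t₀ := fun w => hq.clm_apply continuousAt_const
  have cμ : ContinuousAt (fun t => q t ξ / q t v) t₀ := (cq ξ).div (cq v) hv
  have cη : ContinuousAt (fun t => ξ - (q t ξ / q t v) • v) t₀ :=
    continuousAt_const.sub (cμ.smul continuousAt_const)
  let k : ℝ → ℝ := fun t =>
    (H t (ξ - (q t ξ / q t v) • v) v + H t v (ξ - (q t ξ / q t v) • v)
      + q t ξ / q t v * H t v v) / q t v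
  have ck : ContinuousAt k t₀ := by
    refine ContinuousAt.div ?_ (cq v) hv
    exact (((hH.clm_apply cη).clm_apply continuousAt_const).add
      ((hH.clm_apply continuousAt_const).clm_apply cη)).add
      (cμ.mul ((hH.clm_apply continuousAt_const).clm_apply continuousAt_const))
  refine ⟨|k t₀| + 1, ?_⟩
  filter_upwards [h, (cq v).eventually_ne hv,
    ck.abs.eventually_lt continuousAt_const (lt_add_one |k t₀|)] with t h1 h2 h3
  set μ := q t ξ / q t v with hμ
  set η := ξ - μ • v with hη
  have h4 : q t η = 0 := by
    simp only [hη, hμ, map_sub, map_smul, smul_eq_mul]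
    field_simp
    ring
  have h5 := h1 η h4
  have hξ : ξ = η + μ • v := by simp [hη]
  have h6 : H t ξ ξ = H t η η + q t ξ * k t := by
    have : q t ξ * k t = μ * (H t η v + H t v η + μ * H t v v) := by
      simp only [k, ← hμ, ← hη]
      rw [hμ]
      field_simp
    rw [this]
    conv_lhs => rw [hξ]
    simp only [map_add, map_smul, _root_.add_apply, _root_.smul_apply,
      smul_eq_mul]
    ring
  have h7 : |q t ξ * k t| ≤ (|k t₀| + 1) * |q t ξ| := by
    rw [abs_mul, mul_comm]
    exact mul_le_mul_of_nonneg_right h3.le (abs_nonneg _)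
  have h8 := neg_abs_le (q t ξ * k t)
  linarith

/-- Second order condition for quasiconvexity without critical points. -/
theorem quasiconvexOn_of_hessian_nonneg {K : Set V} (hK : Convex ℝ K) {ψ : V → ℝ}
    (hψ : ∀ p ∈ K, ContDiffAt ℝ 2 ψ p) (h1 : ∀ p ∈ K, fderiv ℝ ψ p ≠ 0)
    (h2 : ∀ p ∈ K, ∀ ξ, fderiv ℝ ψ p ξ = 0 → 0 ≤ fderiv ℝ (fderiv ℝ ψ) p ξ ξ) :
    QuasiconvexOn ℝ K ψ := by
  rw [quasiconvexOn_iff_le_max]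
  refine ⟨hK, ?_⟩
  intro p₀ hp₀ p₁ hp₁ a b ha hb hab
  let ξ := p₁ - p₀
  let γ : ℝ → V := fun t => p₀ + t • ξ
  let f : ℝ → ℝ := fun t => ψ (γ t)
  have hγK : ∀ t ∈ Icc (0 : ℝ) 1, γ t ∈ K := by
    intro t ht
    have := hK hp₀ hp₁ (sub_nonneg.2 ht.2) ht.1 (by ring)
    convert this using 1
    simp only [γ, ξ, smul_sub, sub_smul, one_smul]
    abel
  have hγd : ∀ t, HasDerivAt γ ξ t := fun t => by
    have := ((hasDerivAt_id t).smul_const ξ).const_add p₀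
    rwa [one_smul] at this
  have hγc : Continuous γ := continuous_iff_continuousAt.2 fun t => (hγd t).continuousAt
  have hfd : ∀ t ∈ Icc (0 : ℝ) 1, HasDerivAt f (fderiv ℝ ψ (γ t) ξ) t := fun t ht =>
    ((hψ _ (hγK t ht)).differentiableAt (by norm_num)).hasFDerivAt.comp_hasDerivAt t (hγd t)
  have hfd2 : ∀ t ∈ Icc (0 : ℝ) 1, HasDerivAt (fun r => fderiv ℝ ψ (γ r) ξ)
      (fderiv ℝ (fderiv ℝ ψ) (γ t) ξ ξ) t := by
    intro t ht
    have hd : DifferentiableAt ℝ (fderiv ℝ ψ) (γ t) :=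
      ((hψ _ (hγK t ht)).fderiv_right (m := 1) (by norm_num)).differentiableAt (by norm_num)
    have := (hd.hasFDerivAt.comp_hasDerivAt t (hγd t)).clm_apply (hasDerivAt_const t ξ)
    simpa using this
  have hfc : ContinuousOn f (Icc 0 1) := fun t ht => (hfd t ht).continuousAt.continuousWithinAt
  have hb1 : b ∈ Icc (0 : ℝ) 1 := ⟨hb, by linarith⟩
  have hfb : ψ (a • p₀ + b • p₁) = f b := by
    have : a = 1 - b := by linarith
    simp only [f, γ, ξ, this, smul_sub, sub_smul, one_smul]
    congr 1
    abel
  rw [hfb]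
  have hf0 : f 0 = ψ p₀ := by simp [f, γ]
  have hf1 : f 1 = ψ p₁ := by simp [f, γ, ξ]
  rw [← hf0, ← hf1]
  by_contra hcon
  push Not at hcon
  obtain ⟨tm, htm, hmax⟩ := isCompact_Icc.exists_isMaxOn (nonempty_Icc.2 zero_le_one) hfc
  have hbm : f b ≤ f tm := hmax hb1
  let S : Set ℝ := {t ∈ Icc (0 : ℝ) 1 | f t = f tm}
  have hSc : IsCompact S := by
    refine isCompact_Icc.of_isClosed_subset ?_ (sep_subset _ _)
    exact hfc.preimage_isClosed_of_isClosed isClosed_Icc isClosed_singleton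
  -- The last maximum point on the segment. If quasiconvexity fails it is interior, so `f' = 0`
  -- there.
  obtain ⟨t₂, ht₂, ht₂max⟩ := hSc.exists_isGreatest ⟨tm, htm, rfl⟩
  have hm0 : max (f 0) (f 1) < f t₂ := by rw [ht₂.2]; exact hcon.trans_le hbm
  have h0 : t₂ ≠ 0 := by
    rintro h
    rw [h] at hm0
    exact absurd (le_max_left (f 0) (f 1)) (not_le.2 hm0)
  have h1' : t₂ ≠ 1 := by
    rintro h
    rw [h] at hm0
    exact absurd (le_max_right (f 0) (f 1)) (not_le.2 hm0)
  have hlt0 : 0 < t₂ := lt_of_le_of_ne ht₂.1.1 (Ne.symm h0)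
  have hlt1 : t₂ < 1 := lt_of_le_of_ne ht₂.1.2 h1'
  have hnhds : Icc (0 : ℝ) 1 ∈ 𝓝 t₂ := Icc_mem_nhds hlt0 hlt1
  have hcrit : fderiv ℝ ψ (γ t₂) ξ = 0 := by
    refine IsLocalMax.hasDerivAt_eq_zero (f := f) ?_ (hfd t₂ ht₂.1)
    filter_upwards [hnhds] with t ht
    rw [ht₂.2]
    exact hmax ht
  have hψ' := hψ _ (hγK t₂ ht₂.1)
  have c1 : ContinuousAt (fderiv ℝ ψ) (γ t₂) :=
    (hψ'.fderiv_right (m := 1) (by norm_num)).continuousAt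
  have c2 : ContinuousAt (fderiv ℝ (fderiv ℝ ψ)) (γ t₂) :=
    ((hψ'.fderiv_right (m := 1) (by norm_num)).fderiv_right (m := 0) (by norm_num)).continuousAt
  -- From `f'(t₂) = 0` and `f'' ≥ -k|f'|` it follows that `f' ≥ 0` just after `t₂`. So the maximum
  -- is attained again later, against the choice of `t₂`.
  obtain ⟨k, hkb⟩ := exists_hessian_lower_bound (q := fun t => fderiv ℝ ψ (γ t))
    (H := fun t => fderiv ℝ (fderiv ℝ ψ) (γ t)) (t₀ := t₂) (ξ := ξ)
    (c1.comp hγc.continuousAt) (c2.comp hγc.continuousAt) (h1 _ (hγK t₂ ht₂.1))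
    (by filter_upwards [hnhds] with t ht using h2 _ (hγK t ht))
  obtain ⟨ε, hε, hball⟩ := Metric.mem_nhds_iff.1 (inter_mem hkb hnhds)
  have hsub : Icc t₂ (t₂ + ε / 2) ⊆ Metric.ball t₂ ε := by
    intro t ht
    rw [Metric.mem_ball, Real.dist_eq, abs_lt]
    constructor <;> linarith [ht.1, ht.2]
  have hnn := nonneg_of_deriv_ge_neg_abs (u := fun r => fderiv ℝ ψ (γ r) ξ)
    (fun t ht => hfd2 t (hball (hsub ht)).2) hcrit (fun t ht => (hball (hsub ht)).1)
  have hmono : MonotoneOn f (Icc t₂ (t₂ + ε / 2)) := by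
    refine monotoneOn_of_deriv_nonneg (convex_Icc _ _)
      (hfc.mono fun t ht => (hball (hsub ht)).2) ?_ ?_
    · intro t ht
      exact (hfd t (hball (hsub (interior_subset ht))).2).differentiableAt.differentiableWithinAt
    · intro t ht
      rw [(hfd t (hball (hsub (interior_subset ht))).2).deriv]
      exact hnn t (interior_subset ht)
  have hend : t₂ + ε / 2 ∈ Icc t₂ (t₂ + ε / 2) := ⟨by linarith, le_rfl⟩
  have hle := hmono ⟨le_rfl, by linarith⟩ hend (by linarith)
  have hI := (hball (hsub hend)).2
  have heq : f (t₂ + ε / 2) = f tm := le_antisymm (hmax hI) (by rw [← ht₂.2]; exact hle)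
  have := ht₂max ⟨hI, heq⟩
  linarith

end Quasiconvexity


/-! ### Regularity of the metric coefficients and linearity of their derivatives. -/

section MetricInChart

variable {n : ℕ} {M : Type*} [TopologicalSpace M] [ChartedSpace (Eu n) M]
  [IsManifold 𝓘(ℝ, Eu n) ∞ M]

theorem isManifold_one : IsManifold 𝓘(ℝ, Eu n) 1 M :=
  IsManifold.of_le (n := ∞) (by simp)

/-- In the trivialization of the tangent bundle at `x` this field is the constant `a`. -/
theorem contMDiffAt_coordinate_field (x : M) (a : Eu n) :
    haveI : IsManifold 𝓘(ℝ, Eu n) 1 M := isManifold_one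
    ContMDiffAt 𝓘(ℝ, Eu n) (𝓘(ℝ, Eu n).prod 𝓘(ℝ, Eu n)) 1
      (fun u : Eu n => Bundle.TotalSpace.mk' (Eu n) (E := fun y : M => TangentSpace 𝓘(ℝ, Eu n) y)
        ((extChartAt 𝓘(ℝ, Eu n) x).symm u)
        (mfderiv 𝓘(ℝ, Eu n) 𝓘(ℝ, Eu n) (extChartAt 𝓘(ℝ, Eu n) x).symm u a))
      (extChartAt 𝓘(ℝ, Eu n) x x) := by
  have : IsManifold 𝓘(ℝ, Eu n) 1 M := isManifold_one
  have hnhds := extChartAt_target_mem_nhds (I := 𝓘(ℝ, Eu n)) x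
  rw [Bundle.contMDiffAt_totalSpace]
  refine ⟨(contMDiffOn_extChartAt_symm x).contMDiffAt hnhds, ?_⟩
  refine (contMDiffAt_const (c := a)).congr_of_eventuallyEq ?_
  filter_upwards [hnhds] with u hu
  have hx0 : (extChartAt 𝓘(ℝ, Eu n) x).symm (extChartAt 𝓘(ℝ, Eu n) x x) = x :=
    extChartAt_to_inv x
  have hs : (extChartAt 𝓘(ℝ, Eu n) x).symm u ∈ (chartAt (Eu n) x).source := by
    rw [← extChartAt_source 𝓘(ℝ, Eu n)]
    exact (extChartAt 𝓘(ℝ, Eu n) x).map_target hu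
  simp only [hx0]
  have h1 := TangentBundle.continuousLinearMapAt_trivializationAt (I := 𝓘(ℝ, Eu n)) hs
  have h2 := mfderiv_extChartAt_comp_mfderivWithin_extChartAt_symm (I := 𝓘(ℝ, Eu n)) hu
  have h3 : (trivializationAt (Eu n) (TangentSpace 𝓘(ℝ, Eu n)) x).continuousLinearMapAt ℝ
      ((extChartAt 𝓘(ℝ, Eu n) x).symm u)
      (mfderiv 𝓘(ℝ, Eu n) 𝓘(ℝ, Eu n) (extChartAt 𝓘(ℝ, Eu n) x).symm u a) = a := by
    rw [h1]
    have h4 := congrArg (fun L => L a) h2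
    simp only [modelWithCornersSelf_coe, range_id, mfderivWithin_univ] at h4
    exact h4
  rw [Bundle.Trivialization.continuousLinearMapAt_apply,
    Bundle.Trivialization.coe_linearMapAt_of_mem] at h3
  · exact h3
  · simpa using hs

/-- Needed for the additivity of `metricDeriv` in its last slot: `fderiv` is zero where a function
is not differentiable. That slot carries the gradient in the Christoffel term. -/
theorem differentiableAt_metricInChart (g : RiemMetric n M) (x : M) (a b : Eu n) :
    DifferentiableAt ℝ (fun u => metricInChart g x u a b) (extChartAt 𝓘(ℝ, Eu n) x x) := by
  have : IsManifold 𝓘(ℝ, Eu n) 1 M := isManifold_one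
  have hnhds := extChartAt_target_mem_nhds (I := 𝓘(ℝ, Eu n)) x
  have hb : ContMDiffAt 𝓘(ℝ, Eu n) 𝓘(ℝ, Eu n) 1 (extChartAt 𝓘(ℝ, Eu n) x).symm
      (extChartAt 𝓘(ℝ, Eu n) x x) := (contMDiffOn_extChartAt_symm x).contMDiffAt hnhds
  have hg : ContMDiff 𝓘(ℝ, Eu n) (𝓘(ℝ, Eu n).prod 𝓘(ℝ, Eu n →L[ℝ] Eu n →L[ℝ] ℝ)) 1
    (fun b : M => Bundle.TotalSpace.mk' (Eu n →L[ℝ] Eu n →L[ℝ] ℝ)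
      (E := fun y : M => TangentSpace 𝓘(ℝ, Eu n) y →L[ℝ] TangentSpace 𝓘(ℝ, Eu n) y →L[ℝ] ℝ)
      b (g.inner b)) := g.contMDiff.of_le (by simp)
  have h := ContMDiffAt.clm_bundle_apply₂ (F₁ := Eu n) (F₂ := Eu n) (F₃ := ℝ)
    (E₁ := fun y : M => TangentSpace 𝓘(ℝ, Eu n) y) (E₂ := fun y : M => TangentSpace 𝓘(ℝ, Eu n) y)
    (E₃ := Bundle.Trivial M ℝ)
    (hg.contMDiffAt.comp (extChartAt 𝓘(ℝ, Eu n) x x) hb)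
    (contMDiffAt_coordinate_field x a) (contMDiffAt_coordinate_field x b)
  rw [Bundle.contMDiffAt_totalSpace] at h
  have h2 : ContMDiffAt 𝓘(ℝ, Eu n) 𝓘(ℝ, ℝ) 1 (fun u => metricInChart g x u a b)
    (extChartAt 𝓘(ℝ, Eu n) x x) := h.2
  exact h2.contDiffAt.differentiableAt (by norm_num)

theorem metricDeriv_add_right (g : RiemMetric n M) (x : M) (w a b b' : Eu n) :
    metricDeriv g x w a (b + b') = metricDeriv g x w a b + metricDeriv g x w a b' := by
  have h : (fun u => metricInChart g x u a (b + b')) =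
      (fun u => metricInChart g x u a b) + fun u => metricInChart g x u a b' := by
    funext u
    have key : ∀ (L : Eu n →L[ℝ] Eu n) (B : Eu n →L[ℝ] ℝ), B (L (b + b')) = B (L b) + B (L b') :=
      fun L B => by simp
    exact key _ _
  rw [metricDeriv, h, fderiv_add (differentiableAt_metricInChart g x a b)
    (differentiableAt_metricInChart g x a b')]
  rfl

theorem metricDeriv_smul_right (g : RiemMetric n M) (x : M) (w a b : Eu n) (r : ℝ) :
    metricDeriv g x w a (r • b) = r * metricDeriv g x w a b := by
  have h : (fun u => metricInChart g x u a (r • b)) = r • fun u => metricInChart g x u a b := by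
    funext u
    have key : ∀ (L : Eu n →L[ℝ] Eu n) (B : Eu n →L[ℝ] ℝ), B (L (r • b)) = r • B (L b) :=
      fun L B => by simp
    exact key _ _
  rw [metricDeriv, h, fderiv_const_smul (differentiableAt_metricInChart g x a b)]
  rfl

theorem metricDeriv_add_left (g : RiemMetric n M) (x : M) (w w' a b : Eu n) :
    metricDeriv g x (w + w') a b = metricDeriv g x w a b + metricDeriv g x w' a b := by
  simp [metricDeriv]

theorem metricDeriv_smul_left (g : RiemMetric n M) (x : M) (w a b : Eu n) (r : ℝ) :
    metricDeriv g x (r • w) a b = r * metricDeriv g x w a b := by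
  simp [metricDeriv]

end MetricInChart

/-! ### The cost and its differential in charts. -/

section CostInCharts

variable {n : ℕ} {M N : Type*}
  [TopologicalSpace M] [ChartedSpace (Eu n) M] [IsManifold 𝓘(ℝ, Eu n) ∞ M]
  [TopologicalSpace N] [ChartedSpace (Eu n) N] [IsManifold 𝓘(ℝ, Eu n) ∞ N]

theorem contDiffAt_costInCharts {c : M → N → ℝ} {Ω : Set M} {Λ : Set N}
    (hΩ : IsOpen Ω) (hΛ : IsOpen Λ)
    (hc : ContMDiffOn (𝓘(ℝ, Eu n).prod 𝓘(ℝ, Eu n)) 𝓘(ℝ, ℝ) 4 (fun p : M × N => c p.1 p.2) (Ω ×ˢ Λ))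
    {x₀ x : M} {y₀ y : N} (hx : x ∈ Ω) (hxs : x ∈ (extChartAt 𝓘(ℝ, Eu n) x₀).source)
    (hy : y ∈ Λ) (hys : y ∈ (extChartAt 𝓘(ℝ, Eu n) y₀).source) :
    ContDiffAt ℝ 4 (costInCharts (n := n) c x₀ y₀)
      (extChartAt 𝓘(ℝ, Eu n) x₀ x, extChartAt 𝓘(ℝ, Eu n) y₀ y) := by
  have hu := (isOpen_extChartAt_target (I := 𝓘(ℝ, Eu n)) x₀).mem_nhds
    ((extChartAt 𝓘(ℝ, Eu n) x₀).map_source hxs)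
  have hw := (isOpen_extChartAt_target (I := 𝓘(ℝ, Eu n)) y₀).mem_nhds
    ((extChartAt 𝓘(ℝ, Eu n) y₀).map_source hys)
  have h1 : ContMDiffAt 𝓘(ℝ, Eu n) 𝓘(ℝ, Eu n) 4 (extChartAt 𝓘(ℝ, Eu n) x₀).symm
      (extChartAt 𝓘(ℝ, Eu n) x₀ x) :=
    ((contMDiffOn_extChartAt_symm (n := ∞) x₀).contMDiffAt hu).of_le (WithTop.coe_le_coe.2 (le_top : (4 : ℕ∞) ≤ ⊤))
  have h2 : ContMDiffAt 𝓘(ℝ, Eu n) 𝓘(ℝ, Eu n) 4 (extChartAt 𝓘(ℝ, Eu n) y₀).symm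
      (extChartAt 𝓘(ℝ, Eu n) y₀ y) :=
    ((contMDiffOn_extChartAt_symm (n := ∞) y₀).contMDiffAt hw).of_le (WithTop.coe_le_coe.2 (le_top : (4 : ℕ∞) ≤ ⊤))
  have h3 := h1.prodMap' (p := (extChartAt 𝓘(ℝ, Eu n) x₀ x, extChartAt 𝓘(ℝ, Eu n) y₀ y)) h2
  have h4 : ContMDiffAt (𝓘(ℝ, Eu n).prod 𝓘(ℝ, Eu n)) 𝓘(ℝ, ℝ) 4 (fun p : M × N => c p.1 p.2)
      (Prod.map (extChartAt 𝓘(ℝ, Eu n) x₀).symm (extChartAt 𝓘(ℝ, Eu n) y₀).symm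
        (extChartAt 𝓘(ℝ, Eu n) x₀ x, extChartAt 𝓘(ℝ, Eu n) y₀ y)) := by
    refine hc.contMDiffAt ((hΩ.prod hΛ).mem_nhds ?_)
    simp only [Prod.map, mem_prod]
    rw [(extChartAt 𝓘(ℝ, Eu n) x₀).left_inv hxs, (extChartAt 𝓘(ℝ, Eu n) y₀).left_inv hys]
    exact ⟨hx, hy⟩
  have h5 := h4.comp _ h3
  rw [← modelWithCornersSelf_prod, chartedSpaceSelf_prod] at h5
  exact h5.contDiffAt

theorem costInCharts_swap (c : M → N → ℝ) (x₀ : M) (y₀ : N) :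
    costInCharts (n := n) (fun y x => c x y) y₀ x₀ = costInCharts (n := n) c x₀ y₀ ∘ Prod.swap :=
  rfl

/-- The differential of `c(·, y)` at `x`. -/
noncomputable def covec (c : M → N → ℝ) (x : M) (y : N) : Eu n →L[ℝ] ℝ :=
  mfderiv 𝓘(ℝ, Eu n) 𝓘(ℝ, ℝ) (fun z => c z y) x

theorem mdifferentiableAt_of_chart {f : M → ℝ} {x : M}
    (h : DifferentiableAt ℝ (fun u : Eu n => f ((extChartAt 𝓘(ℝ, Eu n) x).symm u))
      (extChartAt 𝓘(ℝ, Eu n) x x)) : MDifferentiableAt 𝓘(ℝ, Eu n) 𝓘(ℝ, ℝ) f x := by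
  have : IsManifold 𝓘(ℝ, Eu n) 1 M := isManifold_one
  have h1 := h.mdifferentiableAt.comp x
    (mdifferentiableAt_extChartAt (I := 𝓘(ℝ, Eu n)) (mem_chart_source (Eu n) x))
  refine h1.congr_of_eventuallyEq ?_
  filter_upwards [extChartAt_source_mem_nhds (I := 𝓘(ℝ, Eu n)) x] with z hz
  simp only [Function.comp_apply, (extChartAt 𝓘(ℝ, Eu n) x).left_inv hz]

theorem mfderiv_eq_fderiv_chart {f : M → ℝ} {x : M}
    (h : DifferentiableAt ℝ (fun u : Eu n => f ((extChartAt 𝓘(ℝ, Eu n) x).symm u))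
      (extChartAt 𝓘(ℝ, Eu n) x x)) :
    (mfderiv 𝓘(ℝ, Eu n) 𝓘(ℝ, ℝ) f x : Eu n →L[ℝ] ℝ) =
      fderiv ℝ (fun u : Eu n => f ((extChartAt 𝓘(ℝ, Eu n) x).symm u))
      (extChartAt 𝓘(ℝ, Eu n) x x) := by
  rw [(mdifferentiableAt_of_chart h).mfderiv]
  simp only [modelWithCornersSelf_coe, range_id, fderivWithin_univ]
  rfl

end CostInCharts

/-! ### Partial differentials and their local inverses. -/

section PartialInverse

variable {E₁ E₂ : Type*} [NormedAddCommGroup E₁] [NormedSpace ℝ E₁]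
  [NormedAddCommGroup E₂] [NormedSpace ℝ E₂]

theorem dd_comp_swap (F : E₁ × E₂ → ℝ) (v : E₂ × E₁) :
    dd v (F ∘ Prod.swap) = dd v.swap F ∘ Prod.swap := by
  funext p
  have h := (ContinuousLinearEquiv.prodComm ℝ E₂ E₁).comp_right_fderiv (f := F) (x := p)
  have h2 := congrArg (fun L => L v) h
  exact h2

/-- The partial differential in the first variable, as a map of the second. -/
noncomputable def partialLeft (C : E₁ × E₂ → ℝ) (u : E₁) (w : E₂) : E₁ →L[ℝ] ℝ :=
  (fderiv ℝ C (u, w)).comp (ContinuousLinearMap.inl ℝ E₁ E₂)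

theorem partialLeft_apply (C : E₁ × E₂ → ℝ) (u : E₁) (w : E₂) (v : E₁) :
    partialLeft C u w v = dd (v, 0) C (u, w) := rfl

theorem contDiffAt_partialLeft {C : E₁ × E₂ → ℝ} {u : E₁} {w : E₂}
    (hC : ContDiffAt ℝ 4 C (u, w)) : ContDiffAt ℝ 3 (partialLeft C u) w := by
  have h1 : ContDiffAt ℝ 3 (fderiv ℝ C) (u, w) := hC.fderiv_right (by norm_num)
  have h2 : ContDiffAt ℝ 3 (fun w' => fderiv ℝ C (u, w')) w :=
    h1.comp w (contDiffAt_const.prodMk contDiffAt_id)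
  exact h2.clm_comp contDiffAt_const

theorem fderiv_slice_right {F : E₁ × E₂ → ℝ} {u : E₁} {w : E₂} (hF : DifferentiableAt ℝ F (u, w))
    (w' : E₂) : fderiv ℝ (fun r => F (u, r)) w w' = dd (0, w') F (u, w) := by
  have h : HasFDerivAt (fun r : E₂ => (u, r)) (ContinuousLinearMap.inr ℝ E₁ E₂) w :=
    hasFDerivAt_prodMk_right u w
  have h2 : HasFDerivAt (fun r => F (u, r)) _ w := hF.hasFDerivAt.comp w h
  rw [h2.fderiv]
  rfl

theorem fderiv_slice_left {F : E₁ × E₂ → ℝ} {u : E₁} {w : E₂} (hF : DifferentiableAt ℝ F (u, w))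
    (u' : E₁) : fderiv ℝ (fun r => F (r, w)) u u' = dd (u', 0) F (u, w) := by
  have h : HasFDerivAt (fun r : E₁ => (r, w)) (ContinuousLinearMap.inl ℝ E₁ E₂) u :=
    hasFDerivAt_prodMk_left u w
  have h2 : HasFDerivAt (fun r => F (r, w)) _ u := hF.hasFDerivAt.comp u h
  rw [h2.fderiv]
  rfl

theorem fderiv_partialLeft {C : E₁ × E₂ → ℝ} {u : E₁} {w : E₂}
    (hC : ContDiffAt ℝ 4 C (u, w)) (w' : E₂) (v : E₁) :
    fderiv ℝ (partialLeft C u) w w' v = dd (0, w') (dd (v, 0) C) (u, w) := by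
  have h1 : DifferentiableAt ℝ (partialLeft C u) w :=
    (contDiffAt_partialLeft hC).differentiableAt (by norm_num)
  have h2 : DifferentiableAt ℝ (dd (v, 0) C) (u, w) :=
    (dd_contDiffAt (k := 4) (m := 3) hC (by norm_num) _).differentiableAt (by norm_num)
  rw [← fderiv_slice_right h2]
  change _ = fderiv ℝ (fun r => partialLeft C u r v) w w'
  rw [fderiv_clm_apply h1 (differentiableAt_const v)]
  simp

variable [FiniteDimensional ℝ E₁] [FiniteDimensional ℝ E₂]

theorem exists_equiv_of_injective
    (hdim : Module.finrank ℝ E₁ = Module.finrank ℝ E₂) (L : E₂ →L[ℝ] E₁ →L[ℝ] ℝ)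
    (hL : ∀ w, (∀ v, L w v = 0) → w = 0) :
    ∃ e : E₂ ≃L[ℝ] (E₁ →L[ℝ] ℝ), (e : E₂ →L[ℝ] E₁ →L[ℝ] ℝ) = L := by
  have hinj : Function.Injective L.toLinearMap := by
    rw [← LinearMap.ker_eq_bot, LinearMap.ker_eq_bot']
    intro w hw
    refine hL w fun v => ?_
    have : L w = 0 := hw
    rw [this]
    rfl
  have hd : Module.finrank ℝ E₂ = Module.finrank ℝ (E₁ →L[ℝ] ℝ) := by
    rw [← (LinearMap.toContinuousLinearMap (𝕜 := ℝ) (E := E₁) (F' := ℝ)).finrank_eq, ← hdim]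
    exact Subspace.dual_finrank_eq.symm
  exact ⟨(LinearEquiv.ofInjectiveOfFinrankEq L.toLinearMap hinj hd).toContinuousLinearEquiv,
    ContinuousLinearMap.ext fun _ => rfl⟩

/-- The inverse function theorem for `∂ₓC(u, ·)`. One derivative is lost, so the inverse is `C³`.
Its differential is onto, which later provides a `c`-segment with any prescribed velocity. -/
theorem exists_partialLeft_inverse {C : E₁ × E₂ → ℝ} {u : E₁} {w : E₂}
    (hdim : Module.finrank ℝ E₁ = Module.finrank ℝ E₂) (hC : ContDiffAt ℝ 4 C (u, w))
    (hnd : ∀ w', (∀ v, dd (0, w') (dd (v, 0) C) (u, w) = 0) → w' = 0) :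
    ∃ e : (E₁ →L[ℝ] ℝ) → E₂, ContDiffAt ℝ 3 e (partialLeft C u w) ∧
      e (partialLeft C u w) = w ∧
      (∀ w', ∃ α, fderiv ℝ e (partialLeft C u w) α = w') ∧
      ∀ᶠ p in 𝓝 (partialLeft C u w), partialLeft C u (e p) = p := by
  have hP := contDiffAt_partialLeft hC
  obtain ⟨L, hL⟩ := exists_equiv_of_injective hdim (fderiv ℝ (partialLeft C u) w) (by
    intro w' h
    exact hnd w' fun v => by rw [← fderiv_partialLeft hC]; exact h v)
  have hd : HasFDerivAt (partialLeft C u) (L : E₂ →L[ℝ] E₁ →L[ℝ] ℝ) w := by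
    rw [hL]
    exact (hP.differentiableAt (by norm_num)).hasFDerivAt
  have hs := hP.hasStrictFDerivAt' hd (by norm_num)
  have he := hP.to_localInverse hd (by norm_num)
  refine ⟨hP.localInverse hd (by norm_num), he, hP.localInverse_apply_image hd (by norm_num),
    ?_, hs.eventually_right_inverse⟩
  intro w'
  refine ⟨L w', ?_⟩
  have h1 : HasFDerivAt (hs.localInverse (partialLeft C u) L w)
      (L.symm : (E₁ →L[ℝ] ℝ) →L[ℝ] E₂) (partialLeft C u w) :=
    hs.to_localInverse.hasFDerivAt
  change fderiv ℝ (hs.localInverse (partialLeft C u) L w) _ _ = _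
  rw [h1.fderiv]
  simp

end PartialInverse

/-! ### Costs that are regular in both variables. -/

section RegularCost

variable {n : ℕ} {M N : Type*}
  [TopologicalSpace M] [ChartedSpace (Eu n) M] [IsManifold 𝓘(ℝ, Eu n) ∞ M]
  [TopologicalSpace N] [ChartedSpace (Eu n) N] [IsManifold 𝓘(ℝ, Eu n) ∞ N]

/-- A `C⁴` cost, twisted and nondegenerate in both variables, on a pair of open sets each of which
is convex as seen from the other. -/
structure RegularCost (n : ℕ) {M N : Type*}
    [TopologicalSpace M] [ChartedSpace (Eu n) M] [TopologicalSpace N] [ChartedSpace (Eu n) N]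
    (c : M → N → ℝ) (Ω : Set M) (Λ : Set N) : Prop where
  isOpen_left : IsOpen Ω
  isOpen_right : IsOpen Λ
  contMDiffOn : ContMDiffOn (𝓘(ℝ, Eu n).prod 𝓘(ℝ, Eu n)) 𝓘(ℝ, ℝ) 4
    (fun p : M × N => c p.1 p.2) (Ω ×ˢ Λ)
  injOn_right : ∀ x ∈ Ω, InjOn (fun y => covec (n := n) c x y) Λ
  injOn_left : ∀ y ∈ Λ, InjOn (fun x => covec (n := n) (fun y x => c x y) y x) Ω
  nondeg_right : ∀ x ∈ Ω, ∀ y ∈ Λ, ∀ w : Eu n,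
    (∀ v : Eu n, dd (0, w) (dd (v, 0) (costInCharts (n := n) c x y))
      (extChartAt 𝓘(ℝ, Eu n) x x, extChartAt 𝓘(ℝ, Eu n) y y) = 0) → w = 0
  nondeg_left : ∀ x ∈ Ω, ∀ y ∈ Λ, ∀ v : Eu n,
    (∀ w : Eu n, dd (v, 0) (dd (0, w) (costInCharts (n := n) c x y))
      (extChartAt 𝓘(ℝ, Eu n) x x, extChartAt 𝓘(ℝ, Eu n) y y) = 0) → v = 0
  convex_right : ∀ x ∈ Ω, Convex ℝ ((fun y => covec (n := n) c x y) '' Λ)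
  convex_left : ∀ y ∈ Λ, Convex ℝ ((fun x => covec (n := n) (fun y x => c x y) y x) '' Ω)

namespace RegularCost

variable {c : M → N → ℝ} {Ω : Set M} {Λ : Set N}

/-- The maximum principle uses `c`-segments and `c*`-segments together; this duality gives the
second kind from the first. -/
theorem swap (H : RegularCost n c Ω Λ) : RegularCost n (fun y x => c x y) Λ Ω where
  isOpen_left := H.isOpen_right
  isOpen_right := H.isOpen_left
  contMDiffOn := by
    have h : ContMDiffOn (𝓘(ℝ, Eu n).prod 𝓘(ℝ, Eu n)) (𝓘(ℝ, Eu n).prod 𝓘(ℝ, Eu n)) 4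
        (fun p : N × M => (p.2, p.1)) (Λ ×ˢ Ω) :=
      (contMDiff_snd.prodMk contMDiff_fst).contMDiffOn
    exact H.contMDiffOn.comp h fun p hp => ⟨hp.2, hp.1⟩
  injOn_right := H.injOn_left
  injOn_left := H.injOn_right
  nondeg_right := by
    intro y hy x hx v h
    refine H.nondeg_left x hx y hy v fun w => ?_
    have := h w
    rw [costInCharts_swap, dd_comp_swap, dd_comp_swap] at this
    exact this
  nondeg_left := by
    intro y hy x hx w h
    refine H.nondeg_right x hx y hy w fun v => ?_
    have := h v
    rw [costInCharts_swap, dd_comp_swap, dd_comp_swap] at this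
    exact this
  convex_right := H.convex_left
  convex_left := H.convex_right

theorem contDiffAt (H : RegularCost n c Ω Λ) {x₀ x : M} {y₀ y : N} (hx : x ∈ Ω)
    (hxs : x ∈ (extChartAt 𝓘(ℝ, Eu n) x₀).source) (hy : y ∈ Λ)
    (hys : y ∈ (extChartAt 𝓘(ℝ, Eu n) y₀).source) :
    ContDiffAt ℝ 4 (costInCharts (n := n) c x₀ y₀)
      (extChartAt 𝓘(ℝ, Eu n) x₀ x, extChartAt 𝓘(ℝ, Eu n) y₀ y) :=
  contDiffAt_costInCharts H.isOpen_left H.isOpen_right H.contMDiffOn hx hxs hy hys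

theorem contDiffAt_self (H : RegularCost n c Ω Λ) {x : M} {y : N} (hx : x ∈ Ω) (hy : y ∈ Λ) :
    ContDiffAt ℝ 4 (costInCharts (n := n) c x y)
      (extChartAt 𝓘(ℝ, Eu n) x x, extChartAt 𝓘(ℝ, Eu n) y y) :=
  H.contDiffAt hx (mem_extChartAt_source x) hy (mem_extChartAt_source y)

theorem differentiableAt_chart (H : RegularCost n c Ω Λ) {x : M} {y : N} (hx : x ∈ Ω)
    (hy : y ∈ Λ) :
    DifferentiableAt ℝ (fun u : Eu n => c ((extChartAt 𝓘(ℝ, Eu n) x).symm u) y)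
      (extChartAt 𝓘(ℝ, Eu n) x x) := by
  have h := (H.contDiffAt_self hx hy).differentiableAt (by norm_num)
  have h2 := h.comp (extChartAt 𝓘(ℝ, Eu n) x x)
    (hasFDerivAt_prodMk_left (𝕜 := ℝ) (extChartAt 𝓘(ℝ, Eu n) x x)
      (extChartAt 𝓘(ℝ, Eu n) y y)).differentiableAt
  refine h2.congr_of_eventuallyEq (Eventually.of_forall fun u => ?_)
  simp only [Function.comp_apply, costInCharts]
  rw [extChartAt_to_inv]

/-- The chart of `N` may be centred at a point other than `y`, in particular at a boundary point of
`Λ`. -/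
theorem covec_apply (H : RegularCost n c Ω Λ) {x : M} {y₀ y : N} (hx : x ∈ Ω)
    (hy : y ∈ Λ) (hys : y ∈ (extChartAt 𝓘(ℝ, Eu n) y₀).source) (v : Eu n) :
    covec c x y v = dd (v, 0) (costInCharts (n := n) c x y₀)
      (extChartAt 𝓘(ℝ, Eu n) x x, extChartAt 𝓘(ℝ, Eu n) y₀ y) := by
  rw [covec, mfderiv_eq_fderiv_chart (H.differentiableAt_chart hx hy), ← fderiv_slice_left
    ((H.contDiffAt hx (mem_extChartAt_source x) hy hys).differentiableAt (by norm_num))]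
  simp only [costInCharts]
  rw [(extChartAt 𝓘(ℝ, Eu n) y₀).left_inv hys]

theorem covec_eq_partialLeft (H : RegularCost n c Ω Λ) {x : M} {y₀ y : N} (hx : x ∈ Ω)
    (hy : y ∈ Λ) (hys : y ∈ (extChartAt 𝓘(ℝ, Eu n) y₀).source) :
    covec c x y = partialLeft (costInCharts (n := n) c x y₀)
      (extChartAt 𝓘(ℝ, Eu n) x x) (extChartAt 𝓘(ℝ, Eu n) y₀ y) :=
  ContinuousLinearMap.ext fun v => H.covec_apply hx hy hys v

/-- Points of the chart at `y` near `y` come from `Λ`. -/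
theorem eventually_chart_mem {y : N} (hΛ : IsOpen Λ) (hy : y ∈ Λ) :
    ∀ᶠ w in 𝓝 (extChartAt 𝓘(ℝ, Eu n) y y), w ∈ (extChartAt 𝓘(ℝ, Eu n) y).target ∧
      (extChartAt 𝓘(ℝ, Eu n) y).symm w ∈ Λ := by
  refine Eventually.and (extChartAt_target_mem_nhds y) ?_
  refine (continuousAt_extChartAt_symm (I := 𝓘(ℝ, Eu n)) y).eventually_mem ?_
  rw [extChartAt_to_inv]
  exact hΛ.mem_nhds hy

theorem covec_chart_symm (H : RegularCost n c Ω Λ) {x : M} {y : N} (hx : x ∈ Ω) {w : Eu n}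
    (hw : w ∈ (extChartAt 𝓘(ℝ, Eu n) y).target ∧ (extChartAt 𝓘(ℝ, Eu n) y).symm w ∈ Λ) :
    covec c x ((extChartAt 𝓘(ℝ, Eu n) y).symm w) =
      partialLeft (costInCharts (n := n) c x y) (extChartAt 𝓘(ℝ, Eu n) x x) w := by
  rw [H.covec_eq_partialLeft hx hw.2 ((extChartAt 𝓘(ℝ, Eu n) y).map_target hw.1),
    (extChartAt 𝓘(ℝ, Eu n) y).right_inv hw.1]

/-- The local inverse of `y ↦ ∂ₓc(x, y)`, in the chart centred at `y`. -/
theorem exists_local_inverse (H : RegularCost n c Ω Λ) {x : M} {y : N} (hx : x ∈ Ω)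
    (hy : y ∈ Λ) :
    ∃ e : (Eu n →L[ℝ] ℝ) → Eu n, ContDiffAt ℝ 3 e (covec c x y) ∧
      e (covec c x y) = extChartAt 𝓘(ℝ, Eu n) y y ∧
      (∀ w, ∃ α, fderiv ℝ e (covec c x y) α = w) ∧
      ∀ᶠ p in 𝓝 (covec c x y), (e p ∈ (extChartAt 𝓘(ℝ, Eu n) y).target ∧
        (extChartAt 𝓘(ℝ, Eu n) y).symm (e p) ∈ Λ) ∧
        partialLeft (costInCharts (n := n) c x y) (extChartAt 𝓘(ℝ, Eu n) x x) (e p) = p ∧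
        covec c x ((extChartAt 𝓘(ℝ, Eu n) y).symm (e p)) = p := by
  obtain ⟨e, he, he0, hsurj, hinv⟩ := exists_partialLeft_inverse rfl (H.contDiffAt_self hx hy)
    (H.nondeg_right x hx y hy)
  rw [← H.covec_eq_partialLeft hx hy (mem_extChartAt_source y)] at he he0 hsurj hinv
  refine ⟨e, he, he0, hsurj, ?_⟩
  have h1 : Tendsto e (𝓝 (covec c x y)) (𝓝 (extChartAt 𝓘(ℝ, Eu n) y y)) := by
    rw [← he0]
    exact he.continuousAt
  filter_upwards [h1.eventually (eventually_chart_mem H.isOpen_right hy), hinv] with p hp hp2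
  exact ⟨hp, hp2, by rw [H.covec_chart_symm hx hp, hp2]⟩

end RegularCost

end RegularCost

/-! ### From gradients to differentials, and A3W in coordinates. -/

section Gradient

variable {n : ℕ} {M N : Type*}
  [TopologicalSpace M] [ChartedSpace (Eu n) M] [IsManifold 𝓘(ℝ, Eu n) ∞ M]
  [TopologicalSpace N] [ChartedSpace (Eu n) N] [IsManifold 𝓘(ℝ, Eu n) ∞ N]

/-- Lowering the index with the metric, as a linear equivalence in coordinates. -/
theorem exists_flat_equiv (g : RiemMetric n M) (x : M) :
    ∃ e : Eu n ≃L[ℝ] (Eu n →L[ℝ] ℝ), ∀ v w : Eu n, e v w = g.inner x v w := by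
  obtain ⟨e, he⟩ := exists_equiv_of_injective (E₁ := Eu n) (E₂ := Eu n) rfl
    (g.inner x : Eu n →L[ℝ] Eu n →L[ℝ] ℝ) (by
      intro w hw
      by_contra hne
      exact (g.pos x w hne).ne' (hw w))
  exact ⟨e, fun v w => congrArg (fun L : Eu n →L[ℝ] Eu n →L[ℝ] ℝ => L v w) he⟩

/-- `negGrad` as a vector of the model space. -/
noncomputable def negGradCoord (g : RiemMetric n M) (c : M → N → ℝ) (x : M) (y : N) : Eu n :=
  negGrad g c x y

theorem flat_negGradCoord (g : RiemMetric n M) (c : M → N → ℝ) (x : M)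
    {e : Eu n ≃L[ℝ] (Eu n →L[ℝ] ℝ)} (he : ∀ v w : Eu n, e v w = g.inner x v w) (y : N) :
    e (negGradCoord g c x y) = -covec c x y := by
  ext w
  have h := (he (riemGrad g (fun z => c z y) x) w).trans
    (inner_riemGrad g (fun z => c z y) x w)
  have h2 : negGradCoord g c x y = -(show Eu n from riemGrad g (fun z => c z y) x) := rfl
  rw [h2, map_neg]
  exact congrArg Neg.neg h

theorem negGradCoord_eq_iff (g : RiemMetric n M) (c : M → N → ℝ) (x : M) (y y' : N) :
    negGradCoord g c x y = negGradCoord g c x y' ↔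
      covec (n := n) c x y = covec (n := n) c x y' := by
  obtain ⟨e, he⟩ := exists_flat_equiv g x
  rw [← neg_inj (a := covec (n := n) c x y), ← flat_negGradCoord g c x he,
    ← flat_negGradCoord g c x he]
  exact e.injective.eq_iff.symm

/-- Lowering the index and changing sign is a linear isomorphism from `T_xM` to its dual, so it
preserves convexity both ways. -/
theorem isCConvexAt_iff_convex_covec (g : RiemMetric n M) (c : M → N → ℝ) (S : Set N) (x : M) :
    IsCConvexAt g c S x ↔ Convex ℝ ((fun y => covec (n := n) c x y) '' S) := by
  obtain ⟨e, he⟩ := exists_flat_equiv g x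
  have h1 : (fun y => covec (n := n) c x y) '' S =
      (-e.toLinearEquiv.toLinearMap) '' ((fun y => negGradCoord g c x y) '' S) := by
    rw [image_image]
    refine image_congr fun y _ => ?_
    have := flat_negGradCoord g c x he y
    change _ = -(e (negGradCoord g c x y))
    rw [this, neg_neg]
  have h2 : ((fun y => negGradCoord g c x y) '' S) =
      (-e.symm.toLinearEquiv.toLinearMap) '' ((fun y => covec (n := n) c x y) '' S) := by
    rw [image_image]
    refine image_congr fun y _ => ?_
    have := flat_negGradCoord g c x he y
    change _ = -(e.symm (covec c x y))
    rw [← map_neg, ← this]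
    exact (e.symm_apply_apply _).symm
  change Convex ℝ ((fun y => negGradCoord g c x y) '' S) ↔ _
  constructor
  · intro h
    rw [h1]
    exact h.linear_image _
  · intro h
    rw [h2]
    exact h.linear_image _

theorem deriv_deriv_neg_add_affine {D : ℝ → ℝ} (hD : ContDiffAt ℝ 2 D 0) (a b : ℝ) :
    deriv (deriv fun t => -D t + (a + t * b)) 0 = -deriv (deriv D) 0 := by
  have h : deriv (fun t => -D t + (a + t * b)) =ᶠ[𝓝 0] fun t => -deriv D t + b := by
    filter_upwards [eventually_differentiableAt hD] with t ht
    have := (ht.hasDerivAt.neg).add (((hasDerivAt_id t).mul_const b).const_add a)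
    rw [one_mul] at this
    exact this.deriv
  rw [h.deriv_eq]
  have := ((contDiffAt_deriv hD).hasDerivAt.neg).add_const b
  exact this.deriv

/-- The coordinate form of `A3W` at `(x, y)`: along a `c`-segment with respect to `x` issuing
from `y` in the codirection `α`, the second derivative of `∂²c/∂η²` is nonpositive if
`α(η) = 0`. -/
def CrossConcaveAt (c : M → N → ℝ) (x : M) (y : N) : Prop :=
  ∀ (ρ : ℝ → Eu n) (η : Eu n) (α : Eu n →L[ℝ] ℝ), ContDiffAt ℝ 2 ρ 0 →
    ρ 0 = extChartAt 𝓘(ℝ, Eu n) y y →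
    (∀ᶠ t in 𝓝 (0 : ℝ), partialLeft (costInCharts (n := n) c x y) (extChartAt 𝓘(ℝ, Eu n) x x) (ρ t)
      = covec c x y + t • α) → α η = 0 →
    deriv (deriv fun t => dd (η, 0) (dd (η, 0) (costInCharts (n := n) c x y))
      (extChartAt 𝓘(ℝ, Eu n) x x, ρ t)) 0 ≤ 0

variable {c : M → N → ℝ} {Ω : Set M} {Λ : Set N}

theorem inner_self_nonneg' (g : RiemMetric n M) (x : M) (v : TangentSpace 𝓘(ℝ, Eu n) x) :
    0 ≤ g.inner x v v := by
  by_cases h : v = 0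
  · simp [h]
  · exact (g.pos x v h).le

theorem fderiv_fderiv_slice {C : Eu n × Eu n → ℝ} {u w : Eu n} (hC : ContDiffAt ℝ 2 C (u, w))
    (η ζ : Eu n) :
    fderiv ℝ (fderiv ℝ fun r => C (r, w)) u η ζ = dd (η, 0) (dd (ζ, 0) C) (u, w) := by
  have hslice : ContDiffAt ℝ 2 (fun r => C (r, w)) u :=
    hC.comp u (contDiffAt_id.prodMk contDiffAt_const)
  have h1 := dd_dd_apply hslice η ζ
  rw [← h1, dd_apply]
  have hcont : Tendsto (fun r : Eu n => (r, w)) (𝓝 u) (𝓝 (u, w)) :=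
    (continuous_id.prodMk continuous_const).continuousAt
  have h2 : dd ζ (fun r => C (r, w)) =ᶠ[𝓝 u] fun r => dd (ζ, 0) C (r, w) := by
    filter_upwards [hcont.eventually (eventually_contDiffAt (k := 2) hC)] with r hr
    exact fderiv_slice_left (hr.differentiableAt (by norm_num)) ζ
  rw [h2.fderiv_eq]
  exact fderiv_slice_left ((dd_contDiffAt (k := 2) (m := 1) hC (by norm_num) _).differentiableAt
    (by norm_num)) η

/-- The segment `ρ` is `t ↦ c-Exp_x(p + tξ)` read in a chart, where `-α = g(ξ, ·)`; hence `α η = 0`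
means `η ⊥ ξ`. The Riemannian Hessian and `∂²c/∂η²` differ by a term affine in `t`, so the sectional
curvature is minus the second derivative in question. -/
theorem crossConcaveAt_of_A3W (g : RiemMetric n M) (H : RegularCost n c Ω Λ)
    (hA : CostA3W g c Ω Λ) {x : M} {y : N} (hx : x ∈ Ω) (hy : y ∈ Λ) :
    CrossConcaveAt (n := n) c x y := by
  intro ρ η α hρ hρ0 hseg hαη
  obtain ⟨C₀, hC₀, hA⟩ := hA
  obtain ⟨e, he⟩ := exists_flat_equiv g x
  set ξ : Eu n := e.symm (-α) with hξ
  have heξ : e ξ = -α := by simp [hξ]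
  have horth : g.inner x η ξ = 0 := by
    have h1 := he ξ η
    rw [heξ] at h1
    refine (g.symm x η ξ).trans (h1.symm.trans ?_)
    simp [hαη]
  have hS := hA x hx y hy η ξ horth
  have hS0 : 0 ≤ cSectional g c Λ x y η ξ :=
    le_trans (mul_nonneg (mul_nonneg hC₀ (inner_self_nonneg' g x η)) (inner_self_nonneg' g x ξ)) hS
  set u₀ := extChartAt 𝓘(ℝ, Eu n) x x
  set C := costInCharts (n := n) c x y with hCdef
  have hC : ContDiffAt ℝ 4 C (u₀, ρ 0) := by rw [hρ0]; exact H.contDiffAt_self hx hy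
  have hρt : Tendsto ρ (𝓝 0) (𝓝 (extChartAt 𝓘(ℝ, Eu n) y y)) := by
    rw [← hρ0]; exact hρ.continuousAt
  have hpt : Tendsto (fun t => (u₀, ρ t)) (𝓝 0) (𝓝 (u₀, ρ 0)) :=
    (continuousAt_const.prodMk hρ.continuousAt)
  set D : ℝ → ℝ := fun t => dd (η, 0) (dd (η, 0) C) (u₀, ρ t) with hD
  have hD2 : ContDiffAt ℝ 2 D 0 := by
    have h1 : ContDiffAt ℝ 2 (dd (η, 0) (dd (η, 0) C)) (u₀, ρ 0) :=
      dd_contDiffAt (k := 3) (dd_contDiffAt (k := 4) hC (by norm_num) _) (by norm_num) _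
    exact h1.comp (0 : ℝ) (contDiffAt_const.prodMk hρ)
  let p : Eu n := negGradCoord g c x y
  -- The Christoffel correction at the gradient `-(p + tξ)` is `a + t b`.
  let a : ℝ := (metricDeriv g x η η (-p) + metricDeriv g x η η (-p) - metricDeriv g x (-p) η η) / 2
  let b : ℝ := (metricDeriv g x η η (-ξ) + metricDeriv g x η η (-ξ) - metricDeriv g x (-ξ) η η) / 2
  have hev : (fun t : ℝ =>
      -riemHess g (fun z => c z (cExp g c Λ y x (p + t • ξ : Eu n))) x η η) =ᶠ[𝓝 0]
      fun t => -D t + (a + t * b) := by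
    filter_upwards [hseg, hρt.eventually (RegularCost.eventually_chart_mem H.isOpen_right hy),
      hpt.eventually (eventually_contDiffAt (k := 4) hC)] with t h1 h2 h3
    have hcov : covec c x ((extChartAt 𝓘(ℝ, Eu n) y).symm (ρ t)) = covec c x y + t • α := by
      rw [H.covec_chart_symm hx h2, h1]
    have hgrad : negGradCoord g c x ((extChartAt 𝓘(ℝ, Eu n) y).symm (ρ t)) = p + t • ξ := by
      apply e.injective
      rw [flat_negGradCoord g c x he, hcov, map_add, flat_negGradCoord g c x he, map_smul, heξ]
      simp [add_comm]
    have hexp : cExp g c Λ y x (p + t • ξ : Eu n) =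
        (extChartAt 𝓘(ℝ, Eu n) y).symm (ρ t) := by
      -- By injectivity on `Λ`, the inverse that defines `cExp` returns the chart point itself.
      have : Nonempty N := ⟨y⟩
      have hinj : InjOn (fun y' => negGradCoord g c x y') Λ := fun y₁ h₁ y₂ h₂ h =>
        H.injOn_right x hx h₁ h₂ ((negGradCoord_eq_iff g c x y₁ y₂).1 h)
      have h4 := hinj.leftInvOn_invFunOn h2.2
      rw [← h4]
      exact congrArg (Function.invFunOn (fun y' => negGradCoord g c x y') Λ) hgrad.symm
    rw [hexp]
    have hrg : (show Eu n from
        riemGrad g (fun z => c z ((extChartAt 𝓘(ℝ, Eu n) y).symm (ρ t))) x) = -p + t • (-ξ) := by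
      have h5 : (show Eu n from
          riemGrad g (fun z => c z ((extChartAt 𝓘(ℝ, Eu n) y).symm (ρ t))) x)
          = -negGradCoord g c x ((extChartAt 𝓘(ℝ, Eu n) y).symm (ρ t)) := (neg_neg _).symm
      rw [h5, hgrad, neg_add, smul_neg]
    have hmain : fderiv ℝ (fderiv ℝ (fun u : Eu n => c ((extChartAt 𝓘(ℝ, Eu n) x).symm u)
        ((extChartAt 𝓘(ℝ, Eu n) y).symm (ρ t)))) u₀ η η = D t :=
      fderiv_fderiv_slice (C := C) (h3.of_le (by norm_num)) η η
    unfold riemHess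
    rw [hmain]
    have hcor : ∀ q : Eu n, q = -p + t • (-ξ) →
        (metricDeriv g x η η q + metricDeriv g x η η q - metricDeriv g x q η η) / 2 = a + t * b := by
      rintro q rfl
      rw [metricDeriv_add_right, metricDeriv_add_left, metricDeriv_smul_right,
        metricDeriv_smul_left]
      simp only [a, b]
      ring
    have := hcor _ hrg
    linarith
  have hval : cSectional g c Λ x y η ξ = -deriv (deriv D) 0 := by
    unfold cSectional
    refine (hev.iteratedDeriv_eq 2).trans ?_
    rw [iteratedDeriv_succ, iteratedDeriv_one, deriv_deriv_neg_add_affine hD2]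
  linarith

end Gradient

theorem dd_comm_three {V : Type*} [NormedAddCommGroup V] [NormedSpace ℝ V] {F : V → ℝ} {p : V}
    (hF : ContDiffAt ℝ 3 F p) (v w : V) :
    dd v (dd w (dd w F)) p = dd w (dd w (dd v F)) p := by
  rw [dd_comm (dd_contDiffAt (k := 3) (m := 2) hF (by norm_num) w) v w]
  exact (dd_congr (dd_comm_eventually (k := 3) hF (by norm_num) v w) w).eq_of_nhds

/-! ### Segments, and the curvature condition seen from the other variable. -/

section CrossCurvature

variable {n : ℕ} {M N : Type*}
  [TopologicalSpace M] [ChartedSpace (Eu n) M] [IsManifold 𝓘(ℝ, Eu n) ∞ M]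
  [TopologicalSpace N] [ChartedSpace (Eu n) N] [IsManifold 𝓘(ℝ, Eu n) ∞ N]
  {c : M → N → ℝ} {Ω : Set M} {Λ : Set N}

namespace RegularCost

/-- The `c`-segment with respect to `x` through `y`, in the chart centred at `y`. -/
theorem exists_segment (H : RegularCost n c Ω Λ) {x : M} {y : N} (hx : x ∈ Ω) (hy : y ∈ Λ)
    {p α : Eu n →L[ℝ] ℝ} {s : ℝ} (hs : p + s • α = covec c x y) :
    ∃ ρ : ℝ → Eu n, ContDiffAt ℝ 2 ρ s ∧ ρ s = extChartAt 𝓘(ℝ, Eu n) y y ∧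
      ∀ᶠ r in 𝓝 s, (extChartAt 𝓘(ℝ, Eu n) y).symm (ρ r) ∈ Λ ∧
        partialLeft (costInCharts (n := n) c x y) (extChartAt 𝓘(ℝ, Eu n) x x) (ρ r) = p + r • α ∧
        covec c x ((extChartAt 𝓘(ℝ, Eu n) y).symm (ρ r)) = p + r • α := by
  obtain ⟨e, he, he0, -, hev⟩ := H.exists_local_inverse hx hy
  have hl : ContDiffAt ℝ 2 (fun r : ℝ => p + r • α) s :=
    contDiffAt_const.add (contDiffAt_id.smul contDiffAt_const)
  rw [← hs] at he he0 hev
  refine ⟨fun r => e (p + r • α), (he.of_le (by norm_num)).comp s hl, he0, ?_⟩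
  filter_upwards [hl.continuousAt.eventually hev] with r hr
  exact ⟨hr.1.2, hr.2⟩

/-- The `c`-segment with respect to `x` issuing from `y` with a given velocity. -/
theorem exists_segment_deriv (H : RegularCost n c Ω Λ) {x : M} {y : N} (hx : x ∈ Ω) (hy : y ∈ Λ)
    (w : Eu n) :
    ∃ (ρ : ℝ → Eu n) (α : Eu n →L[ℝ] ℝ), ContDiffAt ℝ 2 ρ 0 ∧
      ρ 0 = extChartAt 𝓘(ℝ, Eu n) y y ∧ deriv ρ 0 = w ∧
      ∀ᶠ r in 𝓝 0, partialLeft (costInCharts (n := n) c x y) (extChartAt 𝓘(ℝ, Eu n) x x) (ρ r)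
        = covec c x y + r • α := by
  obtain ⟨e, he, he0, hsurj, hev⟩ := H.exists_local_inverse hx hy
  obtain ⟨α, hα⟩ := hsurj w
  have hl : ContDiffAt ℝ 2 (fun r : ℝ => covec c x y + r • α) 0 :=
    contDiffAt_const.add (contDiffAt_id.smul contDiffAt_const)
  have hs : covec c x y + (0 : ℝ) • α = covec c x y := by simp
  have hl' : HasDerivAt (fun r : ℝ => covec c x y + r • α) α 0 := by
    have := ((hasDerivAt_id (0 : ℝ)).smul_const α).const_add (covec c x y)
    rwa [one_smul] at this
  rw [← hs] at he he0 hev hα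
  refine ⟨fun r => e (covec c x y + r • α), α, (he.of_le (by norm_num)).comp (0 : ℝ) hl, he0, ?_, ?_⟩
  · rw [← hα]
    exact ((he.differentiableAt (by norm_num)).hasFDerivAt.comp_hasDerivAt (0 : ℝ) hl').deriv
  · filter_upwards [hl.continuousAt.eventually hev] with r hr using hr.2.1

/-- Along a `c*`-segment `υ` with respect to `y`, `∂²c/∂w²` is concave if `w` is annihilated by the
codirection of the segment. -/
theorem deriv_deriv_nonpos_of_crossConcaveAt (H : RegularCost n c Ω Λ) {x : M} {y : N}
    (hx : x ∈ Ω) (hy : y ∈ Λ) (hX : CrossConcaveAt (n := n) c x y)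
    {q β : Eu n →L[ℝ] ℝ} {s : ℝ} {υ : ℝ → Eu n} (hυ : ContDiffAt ℝ 2 υ s)
    (hυs : υ s = extChartAt 𝓘(ℝ, Eu n) x x)
    (hseg : ∀ᶠ r in 𝓝 s, ∀ w, dd (0, w) (costInCharts (n := n) c x y)
      (υ r, extChartAt 𝓘(ℝ, Eu n) y y) = q w + r * β w)
    {w : Eu n} (hw : β w = 0) :
    deriv (deriv fun r => dd (0, w) (dd (0, w) (costInCharts (n := n) c x y))
      (υ r, extChartAt 𝓘(ℝ, Eu n) y y)) s ≤ 0 := by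
  obtain ⟨ρ, α, hρ, hρ0, hρw, hρseg⟩ := H.exists_segment_deriv hx hy w
  have hC : ContDiffAt ℝ 4 (costInCharts (n := n) c x y) (υ s, ρ 0) := by
    rw [hυs, hρ0]
    exact H.contDiffAt_self hx hy
  have hρseg' : ∀ v, ∀ᶠ r in 𝓝 0, dd (v, 0) (costInCharts (n := n) c x y) (υ s, ρ r)
      = covec c x y v + r * α v := by
    intro v
    filter_upwards [hρseg] with r hr
    rw [hυs, ← partialLeft_apply, hr]
    rfl
  have hυseg' : ∀ v, ∀ᶠ r in 𝓝 s, dd (0, v) (costInCharts (n := n) c x y) (υ r, ρ 0)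
      = q v + r * β v := by
    intro v
    filter_upwards [hseg] with r hr
    rw [hρ0]
    exact hr v
  have hcross := cross_deriv_symm hC hυ hρ hρseg' hυseg'
  rw [hρw, hρ0] at hcross
  rw [← hcross, hυs]
  refine hX ρ _ α hρ hρ0 hρseg ?_
  -- Orthogonality is transferred: `α(υ')` and `β(w)` are both the mixed derivative `∂_{υ'}∂_w c`,
  -- and `β(w) = 0`.
  have h1 : ∀ v, HasDerivAt (fun r => dd (v, 0) (costInCharts (n := n) c x y) (υ s, ρ r))
      (dd (0, w) (dd (v, 0) (costInCharts (n := n) c x y)) (υ s, ρ 0)) 0 := by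
    intro v
    have hd := (dd_contDiffAt (k := 4) (m := 3) hC (by norm_num) (v, 0)).differentiableAt
      (by norm_num)
    have hγ := (hasDerivAt_const (0 : ℝ) (υ s)).prodMk
      (hρ.differentiableAt (by norm_num)).hasDerivAt
    rw [hρw] at hγ
    exact hd.hasFDerivAt.comp_hasDerivAt (0 : ℝ) hγ
  have h2 : HasDerivAt (fun r => dd (0, w) (costInCharts (n := n) c x y) (υ r, ρ 0))
      (dd (deriv υ s, 0) (dd (0, w) (costInCharts (n := n) c x y)) (υ s, ρ 0)) s := by
    have hd := (dd_contDiffAt (k := 4) (m := 3) hC (by norm_num) (0, w)).differentiableAt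
      (by norm_num)
    have hγ := (hυ.differentiableAt (by norm_num)).hasDerivAt.prodMk (hasDerivAt_const s (ρ 0))
    exact hd.hasFDerivAt.comp_hasDerivAt s hγ
  have h3 : ∀ (t a b : ℝ), HasDerivAt (fun r => a + r * b) b t := fun t a b => by
    simpa using ((hasDerivAt_id t).mul_const b).const_add a
  have h4 := (h1 (deriv υ s)).unique ((h3 0 _ _).congr_of_eventuallyEq (hρseg' (deriv υ s)))
  have h5 := h2.unique ((h3 s _ _).congr_of_eventuallyEq (hυseg' w))
  rw [← h4, dd_comm (hC.of_le (by norm_num)), h5, hw]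

end RegularCost

end CrossCurvature

/-! ### Comparison of second derivatives along a `c`-segment. -/

section CrossCurvature

variable {n : ℕ} {M N : Type*}
  [TopologicalSpace M] [ChartedSpace (Eu n) M] [IsManifold 𝓘(ℝ, Eu n) ∞ M]
  [TopologicalSpace N] [ChartedSpace (Eu n) N] [IsManifold 𝓘(ℝ, Eu n) ∞ N]
  {c : M → N → ℝ} {Ω : Set M} {Λ : Set N}

theorem deriv_deriv_add_affine {D A : ℝ → ℝ} {s a b : ℝ} (hD : ContDiffAt ℝ 2 D s)
    (hA : ∀ᶠ r in 𝓝 s, A r = a + r * b) :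
    deriv (deriv fun r => -(D r + A r)) s = -deriv (deriv D) s := by
  have h : deriv (fun r => -(D r + A r)) =ᶠ[𝓝 s] fun r => -(deriv D r + b) := by
    filter_upwards [eventually_differentiableAt hD, hA.eventually_nhds] with r hr hAr
    have h1 : HasDerivAt A b r := by
      have := ((hasDerivAt_id r).mul_const b).const_add a
      rw [one_mul] at this
      exact this.congr_of_eventuallyEq hAr
    exact (hr.hasDerivAt.add h1).neg.deriv
  rw [h.deriv_eq]
  exact ((contDiffAt_deriv hD).hasDerivAt.add_const b).neg.deriv

namespace RegularCost

/-- Minus the second derivative in `t`, viewed as a function `T` along the `c*`-segment from `x` to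
`z` with respect to `y`, is convex and has zero slope at `x`. The hypothesis `hcrit` says that the
codirection `β` of that segment annihilates `ρ'(0)`, which is where the curvature condition applies.
-/
theorem deriv_deriv_le_of_crossConcaveAt (H : RegularCost n c Ω Λ)
    (hX : ∀ a ∈ Ω, ∀ b ∈ Λ, CrossConcaveAt (n := n) c a b) {x z : M} {y : N}
    (hx : x ∈ Ω) (hz : z ∈ Ω) (hy : y ∈ Λ) {ρ : ℝ → Eu n} {α : Eu n →L[ℝ] ℝ}
    (hρ : ContDiffAt ℝ 2 ρ 0) (hρ0 : ρ 0 = extChartAt 𝓘(ℝ, Eu n) y y)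
    (hseg : ∀ᶠ t in 𝓝 (0 : ℝ), partialLeft (costInCharts (n := n) c x y)
      (extChartAt 𝓘(ℝ, Eu n) x x) (ρ t) = covec c x y + t • α)
    (hcrit : covec (fun y x => c x y) y z (deriv ρ 0) =
      covec (fun y x => c x y) y x (deriv ρ 0)) :
    deriv (deriv fun t => c z ((extChartAt 𝓘(ℝ, Eu n) y).symm (ρ t))) 0 ≤
      deriv (deriv fun t => c x ((extChartAt 𝓘(ℝ, Eu n) y).symm (ρ t))) 0 := by
  set q : Eu n →L[ℝ] ℝ := covec (fun y x => c x y) y x with hq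
  set β : Eu n →L[ℝ] ℝ := covec (fun y x => c x y) y z - q with hβ
  have hβw : β (deriv ρ 0) = 0 := by
    rw [hβ, _root_.sub_apply, hcrit, sub_self]
  have : Nonempty M := ⟨x⟩
  let X : ℝ → M := fun s =>
    Function.invFunOn (fun x => covec (n := n) (fun y x => c x y) y x) Ω (q + s • β)
  have hXeq : ∀ {s : ℝ} {a : M}, a ∈ Ω → covec (n := n) (fun y x => c x y) y a = q + s • β →
      X s = a := by
    intro s a ha h
    simp only [X, ← h]
    exact (H.injOn_left y hy).leftInvOn_invFunOn ha
  let T : ℝ → ℝ := fun s =>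
    -deriv (deriv fun t => c (X s) ((extChartAt 𝓘(ℝ, Eu n) y).symm (ρ t))) 0
  set w₀ := extChartAt 𝓘(ℝ, Eu n) y y with hw₀
  set b : Eu n × Eu n := (0, deriv ρ 0) with hb
  set b' : Eu n × Eu n := (0, deriv (deriv ρ) 0) with hb'
  -- The `c*`-segment need not lie in a single chart, so near each `s` it is read in the chart
  -- centred at its own point `a = X s`.
  have hloc : ∀ (s : ℝ) (a : M), a ∈ Ω → q + s • β = covec (fun y x => c x y) y a →
      ∃ υ : ℝ → Eu n, ContDiffAt ℝ 2 υ s ∧ υ s = extChartAt 𝓘(ℝ, Eu n) a a ∧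
        (∀ᶠ r in 𝓝 s, ∀ w, dd (0, w) (costInCharts (n := n) c a y) (υ r, w₀) = q w + r * β w) ∧
        T =ᶠ[𝓝 s] fun r => -(dd b (dd b (costInCharts (n := n) c a y)) (υ r, w₀)
          + dd b' (costInCharts (n := n) c a y) (υ r, w₀)) := by
    intro s a ha hs
    obtain ⟨υ, hυ, hυs, hev⟩ := H.swap.exists_segment hy ha hs
    have hCa : ContDiffAt ℝ 4 (costInCharts (n := n) c a y) (υ s, w₀) := by
      rw [hυs]
      exact H.contDiffAt_self ha hy
    have ht : Tendsto (fun r => (υ r, w₀)) (𝓝 s) (𝓝 (υ s, w₀)) :=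
      hυ.continuousAt.prodMk continuousAt_const
    refine ⟨υ, hυ, hυs, ?_, ?_⟩
    · filter_upwards [hev] with r hr w
      have h1 := congrArg (fun L => L w) hr.2.1
      simp only [partialLeft_apply] at h1
      rw [costInCharts_swap, dd_comp_swap] at h1
      exact h1
    · filter_upwards [hev, ht.eventually (eventually_contDiffAt (k := 4) hCa)] with r hr hr2
      simp only [T]
      rw [hXeq hr.1 hr.2.2]
      have h2 := deriv_deriv_comp_left (F := costInCharts (n := n) c a y) (u := υ r) (ρ := ρ)
        (t := 0) (by rw [hρ0]; exact hr2.of_le (by norm_num)) hρ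
      rw [hρ0] at h2
      exact congrArg Neg.neg h2
  have hmem : ∀ s ∈ Icc (0 : ℝ) 1, ∃ a ∈ Ω, q + s • β = covec (fun y x => c x y) y a := by
    intro s hs
    obtain ⟨a, ha, hae⟩ := H.convex_left y hy (mem_image_of_mem _ hx) (mem_image_of_mem _ hz)
      (sub_nonneg.2 hs.2) hs.1 (by ring)
    refine ⟨a, ha, ?_⟩
    simp only at hae
    rw [hae, hβ, hq]
    module
  have hCD : ∀ {s : ℝ} {a : M} {υ : ℝ → Eu n}, a ∈ Ω → υ s = extChartAt 𝓘(ℝ, Eu n) a a →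
      ContDiffAt ℝ 4 (costInCharts (n := n) c a y) (υ s, w₀) := by
    intro s a υ ha hυs
    rw [hυs]
    exact H.contDiffAt_self ha hy
  have hQ2 : ∀ {s : ℝ} {a : M} {υ : ℝ → Eu n}, a ∈ Ω → υ s = extChartAt 𝓘(ℝ, Eu n) a a →
      ContDiffAt ℝ 2 υ s →
      ContDiffAt ℝ 2 (fun r => dd b (dd b (costInCharts (n := n) c a y)) (υ r, w₀)) s := by
    intro s a υ ha hυs hυ
    have h1 : ContDiffAt ℝ 2 (dd b (dd b (costInCharts (n := n) c a y))) (υ s, w₀) :=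
      dd_contDiffAt (k := 3) (dd_contDiffAt (k := 4) (hCD ha hυs) (by norm_num) _) (by norm_num) _
    exact h1.comp s (hυ.prodMk contDiffAt_const)
  have hT2 : ∀ s ∈ Icc (0 : ℝ) 1, ContDiffAt ℝ 2 T s := by
    intro s hs
    obtain ⟨a, ha, has⟩ := hmem s hs
    obtain ⟨υ, hυ, hυs, -, hT⟩ := hloc s a ha has
    refine ContDiffAt.congr_of_eventuallyEq ?_ hT
    have h2 : ContDiffAt ℝ 2 (dd b' (costInCharts (n := n) c a y)) (υ s, w₀) :=
      (dd_contDiffAt (k := 4) (m := 3) (hCD ha hυs) (by norm_num) _).of_le (by norm_num)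
    exact ((hQ2 ha hυs hυ).add (h2.comp s (hυ.prodMk contDiffAt_const))).neg
  have hT'' : ∀ s ∈ Icc (0 : ℝ) 1, 0 ≤ deriv (deriv T) s := by
    intro s hs
    obtain ⟨a, ha, has⟩ := hmem s hs
    obtain ⟨υ, hυ, hυs, hυseg, hT⟩ := hloc s a ha has
    rw [hT.deriv.deriv_eq, deriv_deriv_add_affine (hQ2 ha hυs hυ)
      (hυseg.mono fun r hr => hr (deriv (deriv ρ) 0))]
    have := H.deriv_deriv_nonpos_of_crossConcaveAt ha hy (hX a ha y hy) hυ hυs hυseg hβw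
    linarith
  -- Commuting derivatives turns `T'(0)` into minus the second `t`-derivative of `∂_{υ'}c(x, y_t)`,
  -- which is affine in `t`.
  have hT' : HasDerivAt T 0 0 := by
    have h0 : q + (0 : ℝ) • β = covec (fun y x => c x y) y x := by simp [hq]
    obtain ⟨υ, hυ, hυs, -, hT⟩ := hloc 0 x hx h0
    refine HasDerivAt.congr_of_eventuallyEq ?_ hT
    have hC := hCD hx hυs
    set C := costInCharts (n := n) c x y
    have hγ := (hυ.differentiableAt (by norm_num)).hasDerivAt.prodMk (hasDerivAt_const (0 : ℝ) w₀)
    have d1 : HasDerivAt (fun r => dd b (dd b C) (υ r, w₀))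
        (dd (deriv υ 0, 0) (dd b (dd b C)) (υ 0, w₀)) 0 := by
      have h1 : ContDiffAt ℝ 2 (dd b (dd b C)) (υ 0, w₀) :=
        dd_contDiffAt (k := 3) (dd_contDiffAt (k := 4) hC (by norm_num) _) (by norm_num) _
      exact (h1.differentiableAt (by norm_num)).hasFDerivAt.comp_hasDerivAt (0 : ℝ) hγ
    have d2 : HasDerivAt (fun r => dd b' C (υ r, w₀))
        (dd (deriv υ 0, 0) (dd b' C) (υ 0, w₀)) 0 := by
      have h1 : ContDiffAt ℝ 3 (dd b' C) (υ 0, w₀) :=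
        dd_contDiffAt (k := 4) hC (by norm_num) _
      exact (h1.differentiableAt (by norm_num)).hasFDerivAt.comp_hasDerivAt (0 : ℝ) hγ
    have key : dd (deriv υ 0, 0) (dd b (dd b C)) (υ 0, w₀)
        + dd (deriv υ 0, 0) (dd b' C) (υ 0, w₀) = 0 := by
      rw [dd_comm_three (hC.of_le (by norm_num)), dd_comm (hC.of_le (by norm_num))]
      have haff : ∀ᶠ t in 𝓝 (0 : ℝ), dd (deriv υ 0, 0) C (υ 0, ρ t) =
          covec c x y (deriv υ 0) + t * α (deriv υ 0) := by
        filter_upwards [hseg] with t ht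
        rw [hυs, ← partialLeft_apply, ht]
        rfl
      have h3 := deriv_deriv_of_eventually_affine haff
      rw [deriv_deriv_comp_left (by
        rw [hρ0]
        exact (dd_contDiffAt (k := 4) (m := 3) hC (by norm_num) _).of_le (by norm_num)) hρ,
        hρ0] at h3
      exact h3
    have := (d1.add d2).neg
    rw [key, neg_zero] at this
    exact this
  have hconv : ConvexOn ℝ (Icc (0 : ℝ) 1) T := by
    refine convexOn_of_deriv2_nonneg (convex_Icc _ _)
      (fun s hs => (hT2 s hs).continuousAt.continuousWithinAt)
      (fun s hs => ((hT2 s (interior_subset hs)).differentiableAt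
        (by norm_num)).differentiableWithinAt)
      (fun s hs => (contDiffAt_deriv (hT2 s (interior_subset hs))).differentiableWithinAt)
      (fun s hs => hT'' s (interior_subset hs))
  have hslope := hconv.le_slope_of_hasDerivAt (by simp) (by simp) zero_lt_one hT'
  rw [slope_def_field] at hslope
  have hX0 : X 0 = x := hXeq hx (by simp [hq])
  have hX1 : X 1 = z := hXeq hz (by simp [hβ])
  simp only [T, hX0, hX1] at hslope
  linarith

end RegularCost

end CrossCurvature

/-! ### Loeper's maximum principle in the interior. -/

section MaximumPrinciple

theorem deriv_deriv_sub {f h : ℝ → ℝ} {t : ℝ} (hf : ContDiffAt ℝ 2 f t) (hh : ContDiffAt ℝ 2 h t) :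
    deriv (deriv fun r => f r - h r) t = deriv (deriv f) t - deriv (deriv h) t := by
  have h1 : deriv (fun r => f r - h r) =ᶠ[𝓝 t] fun r => deriv f r - deriv h r := by
    filter_upwards [eventually_differentiableAt hf, eventually_differentiableAt hh] with r h1 h2
    exact (h1.hasDerivAt.sub h2.hasDerivAt).deriv
  rw [h1.deriv_eq]
  exact ((contDiffAt_deriv hf).hasDerivAt.sub (contDiffAt_deriv hh).hasDerivAt).deriv

theorem deriv_deriv_along_line {V : Type*} [NormedAddCommGroup V] [NormedSpace ℝ V] {F : V → ℝ}
    {p : V} (hF : ContDiffAt ℝ 2 F p) (ξ : V) :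
    deriv (deriv fun t : ℝ => F (p + t • ξ)) 0 = fderiv ℝ (fderiv ℝ F) p ξ ξ := by
  have hγd : ∀ t : ℝ, HasDerivAt (fun t : ℝ => p + t • ξ) ξ t := fun t => by
    have := ((hasDerivAt_id t).smul_const ξ).const_add p
    rwa [one_smul] at this
  have h1 : deriv (fun t : ℝ => p + t • ξ) = fun _ => ξ := funext fun t => (hγd t).deriv
  have hγ : ContDiffAt ℝ 2 (fun t : ℝ => p + t • ξ) 0 :=
    contDiffAt_const.add (contDiffAt_id.smul contDiffAt_const)
  have h2 := deriv_deriv_comp (F := F) (γ := fun t : ℝ => p + t • ξ) (t := 0) (by simpa using hF) hγ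
  rw [h2, h1]
  simp only [zero_smul, add_zero, deriv_const]
  rw [dd_dd_apply hF, dd_apply, map_zero, add_zero]

variable {n : ℕ} {M N : Type*}
  [TopologicalSpace M] [ChartedSpace (Eu n) M] [IsManifold 𝓘(ℝ, Eu n) ∞ M]
  [TopologicalSpace N] [ChartedSpace (Eu n) N] [IsManifold 𝓘(ℝ, Eu n) ∞ N]
  {c : M → N → ℝ} {Ω : Set M} {Λ : Set N}

namespace RegularCost

theorem contDiffAt_chart_right (H : RegularCost n c Ω Λ) {a : M} {y : N} (ha : a ∈ Ω)
    (hy : y ∈ Λ) :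
    ContDiffAt ℝ 4 (fun w : Eu n => c a ((extChartAt 𝓘(ℝ, Eu n) y).symm w))
      (extChartAt 𝓘(ℝ, Eu n) y y) := by
  have h := (H.contDiffAt_self ha hy).comp (extChartAt 𝓘(ℝ, Eu n) y y)
    (contDiffAt_const.prodMk contDiffAt_id)
  refine h.congr_of_eventuallyEq (Eventually.of_forall fun w => ?_)
  simp only [Function.comp_apply, costInCharts]
  rw [extChartAt_to_inv]

/-- The inverse of `y ↦ ∂ₓc(x, y)` on `Λ`, in the chart centred at one of its values. -/
theorem eventuallyEq_chart_of_rightInverse {x : M} {y : N}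
    {E : (Eu n →L[ℝ] ℝ) → N} (hE : ∀ y ∈ Λ, E (covec c x y) = y)
    {e : (Eu n →L[ℝ] ℝ) → Eu n} (he : ∀ᶠ p in 𝓝 (covec c x y),
      (extChartAt 𝓘(ℝ, Eu n) y).symm (e p) ∈ Λ ∧
        covec c x ((extChartAt 𝓘(ℝ, Eu n) y).symm (e p)) = p) :
    E =ᶠ[𝓝 (covec c x y)] fun p => (extChartAt 𝓘(ℝ, Eu n) y).symm (e p) := by
  filter_upwards [he] with p hp
  have := hE _ hp.1
  rwa [hp.2] at this

/-- Loeper's maximum principle, in the coordinates `∂ₓc(x, ·)` on `Λ`. -/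
theorem quasiconvexOn_sub (H : RegularCost n c Ω Λ)
    (hX : ∀ a ∈ Ω, ∀ b ∈ Λ, CrossConcaveAt (n := n) c a b) {x z : M} (hx : x ∈ Ω) (hz : z ∈ Ω)
    {E : (Eu n →L[ℝ] ℝ) → N} (hE : ∀ y ∈ Λ, E (covec c x y) = y) :
    QuasiconvexOn ℝ ((fun y => covec (n := n) c x y) '' Λ) fun p => c x (E p) - c z (E p) := by
  -- For `x = z` the function is zero and all points are critical, so the criterion does not apply.
  by_cases hxz : x = z
  · subst hxz
    simp only [sub_self]
    rw [quasiconvexOn_iff_le_max]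
    exact ⟨H.convex_right x hx, fun _ _ _ _ _ _ _ _ _ => by simp⟩
  suffices h : ∀ y ∈ Λ, ContDiffAt ℝ 2 (fun p => c x (E p) - c z (E p)) (covec c x y) ∧
      fderiv ℝ (fun p => c x (E p) - c z (E p)) (covec c x y) ≠ 0 ∧
      ∀ ξ, fderiv ℝ (fun p => c x (E p) - c z (E p)) (covec c x y) ξ = 0 →
        0 ≤ fderiv ℝ (fderiv ℝ fun p => c x (E p) - c z (E p)) (covec c x y) ξ ξ by
    refine quasiconvexOn_of_hessian_nonneg (H.convex_right x hx) ?_ ?_ ?_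
    · rintro _ ⟨y, hy, rfl⟩
      exact (h y hy).1
    · rintro _ ⟨y, hy, rfl⟩
      exact (h y hy).2.1
    · rintro _ ⟨y, hy, rfl⟩
      exact (h y hy).2.2
  intro y hy
  obtain ⟨e, he, he0, hsurj, hev⟩ := H.exists_local_inverse hx hy
  have hEe := eventuallyEq_chart_of_rightInverse hE (hev.mono fun p hp => ⟨hp.1.2, hp.2.2⟩)
  set p₀ := covec (n := n) c x y
  have hψ : (fun p => c x (E p) - c z (E p)) =ᶠ[𝓝 p₀]
      fun p => c x ((extChartAt 𝓘(ℝ, Eu n) y).symm (e p))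
        - c z ((extChartAt 𝓘(ℝ, Eu n) y).symm (e p)) := by
    filter_upwards [hEe] with p hp
    rw [hp]
  have hcd : ∀ a ∈ Ω, ContDiffAt ℝ 4 (fun w : Eu n => c a ((extChartAt 𝓘(ℝ, Eu n) y).symm w))
      (e p₀) := fun a ha => by
    rw [he0]
    exact H.contDiffAt_chart_right ha hy
  have hce : ∀ a ∈ Ω, ContDiffAt ℝ 3 (fun p => c a ((extChartAt 𝓘(ℝ, Eu n) y).symm (e p))) p₀ :=
    fun a ha => ((hcd a ha).of_le (by norm_num)).comp p₀ he
  have hdiff : DifferentiableAt ℝ e p₀ := he.differentiableAt (by norm_num)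
  have hcf : ∀ a ∈ Ω, ∀ ξ, fderiv ℝ (fun p => c a ((extChartAt 𝓘(ℝ, Eu n) y).symm (e p))) p₀ ξ =
      covec (fun y x => c x y) y a (fderiv ℝ e p₀ ξ) := by
    intro a ha ξ
    have h1 := ((hcd a ha).differentiableAt (by norm_num)).hasFDerivAt.comp p₀ hdiff.hasFDerivAt
    have h2 : HasFDerivAt (fun p => c a ((extChartAt 𝓘(ℝ, Eu n) y).symm (e p))) _ p₀ := h1
    rw [h2.fderiv, covec, mfderiv_eq_fderiv_chart (H.swap.differentiableAt_chart hy ha), he0]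
    rfl
  have hψd : ∀ ξ, fderiv ℝ (fun p => c x (E p) - c z (E p)) p₀ ξ =
      covec (fun y x => c x y) y x (fderiv ℝ e p₀ ξ)
        - covec (fun y x => c x y) y z (fderiv ℝ e p₀ ξ) := by
    intro ξ
    rw [hψ.fderiv_eq, ← hcf x hx, ← hcf z hz,
      fderiv_fun_sub ((hce x hx).differentiableAt (by norm_num))
        ((hce z hz).differentiableAt (by norm_num))]
    rfl
  have hψ3 : ContDiffAt ℝ 2 (fun p => c x (E p) - c z (E p)) p₀ :=
    (((hce x hx).sub (hce z hz)).of_le (by norm_num)).congr_of_eventuallyEq hψ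
  refine ⟨hψ3, ?_, ?_⟩
  -- At a critical point `∂_y c(x,y) = ∂_y c(z,y)`, since the differential of `e` is onto; A1 in the
  -- other variable then forces `x = z`.
  · intro h0
    refine hxz (H.injOn_left y hy hx hz ?_)
    refine ContinuousLinearMap.ext fun w => ?_
    obtain ⟨ξ, rfl⟩ := hsurj w
    have := hψd ξ
    rw [h0] at this
    exact (sub_eq_zero.1 this.symm)
  · intro ξ hξ
    rw [hψd ξ] at hξ
    have hl : ContDiffAt ℝ 2 (fun t : ℝ => p₀ + t • ξ) 0 :=
      contDiffAt_const.add (contDiffAt_id.smul contDiffAt_const)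
    have hl0 : p₀ + (0 : ℝ) • ξ = p₀ := by simp
    have hlt : Tendsto (fun t : ℝ => p₀ + t • ξ) (𝓝 0) (𝓝 p₀) := by
      have := hl.continuousAt
      rwa [ContinuousAt, hl0] at this
    have hl' : HasDerivAt (fun t : ℝ => p₀ + t • ξ) ξ 0 := by
      have := ((hasDerivAt_id (0 : ℝ)).smul_const ξ).const_add p₀
      rwa [one_smul] at this
    have hρ : ContDiffAt ℝ 2 (fun t : ℝ => e (p₀ + t • ξ)) 0 :=
      ContDiffAt.comp (0 : ℝ) (by rw [hl0]; exact he.of_le (by norm_num)) hl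
    have hρd : deriv (fun t : ℝ => e (p₀ + t • ξ)) 0 = fderiv ℝ e p₀ ξ := by
      have h1 : HasFDerivAt e (fderiv ℝ e p₀) (p₀ + (0 : ℝ) • ξ) := by
        rw [hl0]
        exact hdiff.hasFDerivAt
      exact (h1.comp_hasDerivAt (0 : ℝ) hl').deriv
    have hmain := H.deriv_deriv_le_of_crossConcaveAt hX hx hz hy hρ (by simp only [hl0, he0])
      (α := ξ) ((hlt.eventually hev).mono fun t ht => ht.2.1) (by
        rw [hρd]
        linarith)
    rw [← deriv_deriv_along_line hψ3]
    have hψline : (fun t : ℝ => c x (E (p₀ + t • ξ)) - c z (E (p₀ + t • ξ))) =ᶠ[𝓝 0]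
        fun t => c x ((extChartAt 𝓘(ℝ, Eu n) y).symm (e (p₀ + t • ξ)))
        - c z ((extChartAt 𝓘(ℝ, Eu n) y).symm (e (p₀ + t • ξ))) := hlt.eventually hψ
    have hcl : ∀ a ∈ Ω, ContDiffAt ℝ 2
        (fun t : ℝ => c a ((extChartAt 𝓘(ℝ, Eu n) y).symm (e (p₀ + t • ξ)))) 0 := fun a ha =>
      ContDiffAt.comp (g := fun p => c a ((extChartAt 𝓘(ℝ, Eu n) y).symm (e p))) (0 : ℝ)
        (by rw [hl0]; exact (hce a ha).of_le (by norm_num)) hl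
    rw [hψline.deriv.deriv_eq, deriv_deriv_sub (hcl x hx) (hcl z hz)]
    linarith

end RegularCost

end MaximumPrinciple

/-! ### The mixed Hessian as a bilinear form, and the passage from A0, A1, A2 to `RegularCost`. -/

section MixedHessian

variable {n : ℕ}

/-- The bilinear form `(w, v) ↦ ∑ Aᵢⱼ vᵢ wⱼ`. -/
noncomputable def matrixForm (A : Matrix (Fin n) (Fin n) ℝ) : Eu n →L[ℝ] Eu n →L[ℝ] ℝ :=
  ∑ i, ∑ j, A i j • (EuclideanSpace.proj j : Eu n →L[ℝ] ℝ).smulRight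
    (EuclideanSpace.proj i : Eu n →L[ℝ] ℝ)

theorem matrixForm_apply (A : Matrix (Fin n) (Fin n) ℝ) (w v : Eu n) :
    matrixForm A w v = ∑ i, v i * ∑ j, A i j * w j := by
  simp only [matrixForm, _root_.sum_apply, _root_.smul_apply, ContinuousLinearMap.smulRight_apply,
    smul_eq_mul, Finset.mul_sum]
  refine Finset.sum_congr rfl fun i _ => Finset.sum_congr rfl fun j _ => ?_
  change A i j * (w j * v i) = v i * (A i j * w j)
  ring

theorem continuous_matrixForm : Continuous (matrixForm (n := n)) := by
  rw [continuous_clm_apply]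
  intro w
  rw [continuous_clm_apply]
  intro v
  simp only [matrixForm_apply]
  exact continuous_finsetSum _ fun i _ => continuous_const.mul
    (continuous_finsetSum _ fun j _ => (continuous_id.matrix_elem i j).mul continuous_const)

theorem euclidean_eq_sum (w : Eu n) : w = ∑ j, w j • EuclideanSpace.single j (1 : ℝ) := by
  have := (EuclideanSpace.basisFun (Fin n) ℝ).sum_repr w
  simpa using this.symm

theorem eq_matrixForm (B : Eu n →L[ℝ] Eu n →L[ℝ] ℝ) :
    B = matrixForm (Matrix.of fun i j =>
      B (EuclideanSpace.single j 1) (EuclideanSpace.single i 1)) := by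
  ext w v
  rw [matrixForm_apply]
  conv_lhs => rw [euclidean_eq_sum w, euclidean_eq_sum v]
  simp only [map_sum, map_smul, _root_.sum_apply, _root_.smul_apply,
    smul_eq_mul, Matrix.of_apply, Finset.mul_sum]
  refine Finset.sum_congr rfl fun i _ => Finset.sum_congr rfl fun j _ => ?_
  ring

theorem eq_zero_of_matrixForm_right {A : Matrix (Fin n) (Fin n) ℝ} (hA : A.det ≠ 0) {w : Eu n}
    (h : ∀ v, matrixForm A w v = 0) : w = 0 := by
  have h1 : A.mulVec w.ofLp = 0 := by
    funext i
    have := h (EuclideanSpace.single i 1)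
    rw [matrixForm_apply] at this
    simpa [Matrix.mulVec, dotProduct] using this
  have h2 := Matrix.eq_zero_of_mulVec_eq_zero hA h1
  ext i
  exact congrFun h2 i

theorem eq_zero_of_matrixForm_left {A : Matrix (Fin n) (Fin n) ℝ} (hA : A.det ≠ 0) {v : Eu n}
    (h : ∀ w, matrixForm A w v = 0) : v = 0 := by
  have h1 : Matrix.vecMul v.ofLp A = 0 := by
    funext j
    have := h (EuclideanSpace.single j 1)
    rw [matrixForm_apply] at this
    simpa [Matrix.vecMul, dotProduct] using this
  have h2 := Matrix.eq_zero_of_vecMul_eq_zero hA h1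
  ext i
  exact congrFun h2 i

variable {M N : Type*}
  [TopologicalSpace M] [ChartedSpace (Eu n) M] [IsManifold 𝓘(ℝ, Eu n) ∞ M]
  [TopologicalSpace N] [ChartedSpace (Eu n) N] [IsManifold 𝓘(ℝ, Eu n) ∞ N]
  {c : M → N → ℝ} {Ω : Set M} {Λ : Set N}

theorem fderiv_partialLeft_eq_matrixForm {x₀ x : M} {y₀ y : N}
    (hC : ContDiffAt ℝ 4 (costInCharts (n := n) c x₀ y₀)
      (extChartAt 𝓘(ℝ, Eu n) x₀ x, extChartAt 𝓘(ℝ, Eu n) y₀ y)) :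
    fderiv ℝ (partialLeft (costInCharts (n := n) c x₀ y₀) (extChartAt 𝓘(ℝ, Eu n) x₀ x))
      (extChartAt 𝓘(ℝ, Eu n) y₀ y) = matrixForm (mixedHess c x₀ y₀ x y) := by
  rw [eq_matrixForm (fderiv ℝ _ _)]
  congr 1
  ext i j
  simp only [Matrix.of_apply, mixedHess]
  rw [fderiv_partialLeft hC, dd_apply, ← dd_apply, ← fderiv_slice_right
    ((dd_contDiffAt (k := 4) (m := 3) hC (by norm_num) _).differentiableAt (by norm_num))]
  have ht : Tendsto (fun w : Eu n => (extChartAt 𝓘(ℝ, Eu n) x₀ x, w))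
      (𝓝 (extChartAt 𝓘(ℝ, Eu n) y₀ y))
      (𝓝 (extChartAt 𝓘(ℝ, Eu n) x₀ x, extChartAt 𝓘(ℝ, Eu n) y₀ y)) :=
    (continuous_const.prodMk continuous_id).continuousAt
  refine congrArg (fun L : Eu n →L[ℝ] ℝ => L (EuclideanSpace.single j 1)) (EventuallyEq.fderiv_eq ?_)
  filter_upwards [ht.eventually (eventually_contDiffAt (k := 4) hC)] with w hw
  exact (fderiv_slice_left (hw.differentiableAt (by norm_num)) _).symm

theorem regularCost_of_hypotheses (g : RiemMetric n M) (h : RiemMetric n N)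
    (hΩ : IsOpen Ω) (hΛ : IsOpen Λ)
    (hA0 : CostA0 (n := n) c Ω Λ) (hA1 : CostA1 g h c Ω Λ) (hA2 : CostA2 (n := n) c Ω Λ)
    (hcΛ : ∀ x ∈ Ω, IsCConvexAt g c Λ x)
    (hcΩ : ∀ y ∈ Λ, IsCConvexAt h (fun y x => c x y) Ω y) : RegularCost n c Ω Λ := by
  have hC : ∀ x ∈ Ω, ∀ y ∈ Λ, ContDiffAt ℝ 4 (costInCharts (n := n) c x y)
      (extChartAt 𝓘(ℝ, Eu n) x x, extChartAt 𝓘(ℝ, Eu n) y y) := fun x hx y hy =>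
    contDiffAt_costInCharts hΩ hΛ hA0.contMDiffOn hx (mem_extChartAt_source x) hy
      (mem_extChartAt_source y)
  have hdet : ∀ x ∈ Ω, ∀ y ∈ Λ, (mixedHess (n := n) c x y x y).det ≠ 0 := by
    intro x hx y hy
    obtain ⟨A, hA, hlim⟩ := hA2 x (subset_closure hx) y (subset_closure hy)
    rw [(hΩ.prod hΛ).nhdsWithin_eq ⟨hx, hy⟩] at hlim
    -- At an interior point the limit is along a full neighbourhood filter, so the matrix of A2 is
    -- the actual value.
    have := eq_of_tendsto_nhds hlim
    simp only at this
    rwa [this]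
  refine ⟨hΩ, hΛ, hA0.contMDiffOn, ?_, ?_, ?_, ?_, ?_, ?_⟩
  · intro x hx y₁ h₁ y₂ h₂ heq
    exact hA1.1 x hx (subset_closure h₁) (subset_closure h₂)
      ((negGradCoord_eq_iff g c x y₁ y₂).2 heq)
  · intro y hy x₁ h₁ x₂ h₂ heq
    exact hA1.2 y hy (subset_closure h₁) (subset_closure h₂)
      ((negGradCoord_eq_iff h (fun y x => c x y) y x₁ x₂).2 heq)
  · intro x hx y hy w hw
    refine eq_zero_of_matrixForm_right (hdet x hx y hy) fun v => ?_
    rw [← fderiv_partialLeft_eq_matrixForm (hC x hx y hy), fderiv_partialLeft (hC x hx y hy)]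
    exact hw v
  · intro x hx y hy v hv
    refine eq_zero_of_matrixForm_left (hdet x hx y hy) fun w => ?_
    rw [← fderiv_partialLeft_eq_matrixForm (hC x hx y hy), fderiv_partialLeft (hC x hx y hy),
      dd_comm ((hC x hx y hy).of_le (by norm_num))]
    exact hv w
  · exact fun x hx => (isCConvexAt_iff_convex_covec g c Λ x).1 (hcΛ x hx)
  · exact fun y hy => (isCConvexAt_iff_convex_covec h (fun y x => c x y) Ω y).1 (hcΩ y hy)

end MixedHessian

/-! ### The contact set as a family of inequalities. -/

section ContactSet

variable {X Y : Type*} [TopologicalSpace Y] {c : X → Y → ℝ} {Ω : Set X} {Λ : Set Y} {φ : X → ℝ}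

/-- Contact means that the supremum over `z` is attained at `z = x`; this also disposes of the
extended reals. -/
theorem mem_contactSet_iff {x : X} (hx : x ∈ Ω) {y : Y} :
    y ∈ contactSet c Ω Λ φ x ↔
      y ∈ closure Λ ∧ ∀ z ∈ Ω, c x y - c z y ≤ φ z - φ x := by
  refine and_congr_right fun _ => ?_
  have hcoe : ∀ z, ((-c z y : ℝ) : EReal) - (φ z : EReal) = ((-c z y - φ z : ℝ) : EReal) :=
    fun z => (EReal.coe_sub _ _).symm
  unfold cLegendre
  simp only [hcoe]
  constructor
  · intro h z hz
    have h1 : ((-c z y - φ z : ℝ) : EReal) ≤ ⨆ z ∈ Ω, ((-c z y - φ z : ℝ) : EReal) :=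
      le_iSup₂ (f := fun z (_ : z ∈ Ω) => ((-c z y - φ z : ℝ) : EReal)) z hz
    have h2 := add_le_add_right h1 (φ x : EReal)
    rw [h, ← EReal.coe_add, EReal.coe_le_coe_iff] at h2
    linarith
  · intro h
    have h1 : (⨆ z ∈ Ω, ((-c z y - φ z : ℝ) : EReal)) = ((-c x y - φ x : ℝ) : EReal) := by
      refine le_antisymm (iSup₂_le fun z hz => ?_)
        (le_iSup₂ (f := fun z (_ : z ∈ Ω) => ((-c z y - φ z : ℝ) : EReal)) x hx)
      rw [EReal.coe_le_coe_iff]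
      have := h z hz
      linarith
    rw [h1, ← EReal.coe_add]
    congr 1
    ring

theorem contactSet_nonempty (hφ : IsCConvexFunction c Ω Λ φ) {x : X} (hx : x ∈ Ω) :
    (contactSet c Ω Λ φ x).Nonempty := by
  obtain ⟨v, hv, -, hsup, hatt⟩ := hφ
  obtain ⟨y, hy, hxy⟩ := hatt x hx
  refine ⟨y, (mem_contactSet_iff hx).2 ⟨hy, fun z hz => ?_⟩⟩
  have h1 : ((-c z y : ℝ) : EReal) - v y ≤ φ z := by
    rw [hsup z hz]
    exact le_iSup₂ (f := fun y (_ : y ∈ closure Λ) => ((-c z y : ℝ) : EReal) - v y) y hy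
  have hvbot := hv y hy
  generalize v y = r at *
  induction r with
  | bot => exact absurd rfl hvbot
  | top =>
    rw [EReal.coe_add_top] at hxy
    exact absurd hxy.symm (EReal.coe_ne_top _)
  | coe r =>
    rw [← EReal.coe_add, EReal.coe_eq_coe_iff] at hxy
    rw [← EReal.coe_sub, EReal.coe_le_coe_iff] at h1
    linarith

end ContactSet

/-! ### Extension to closures and Lipschitz estimates. -/

section Topology

/-- The extension by continuity from `A` is continuous because the target is regular, and it agrees
with `f` by uniqueness of limits. -/
theorem continuousOn_closure_of_tendsto {X Y : Type*} [TopologicalSpace X] [TopologicalSpace Y]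
    [RegularSpace Y] [T2Space Y] {f : X → Y} {A : Set X}
    (h : ∀ x ∈ closure A, Tendsto f (𝓝[A] x) (𝓝 (f x))) : ContinuousOn f (closure A) := by
  refine (continuousOn_extendFrom Subset.rfl fun x hx => ⟨f x, h x hx⟩).congr fun x hx => ?_
  exact (extendFrom_eq hx (h x hx)).symm

/-- A real function which is locally `C`-Lipschitz near a convex set is `C`-Lipschitz on it. -/
theorem le_add_mul_norm_of_local {V : Type*} [NormedAddCommGroup V] [NormedSpace ℝ V] {K : Set V}
    (hK : Convex ℝ K) {f : V → ℝ} {C : ℝ}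
    (hf : ∀ p ∈ K, ∀ᶠ q in 𝓝 p, |f q - f p| ≤ C * ‖q - p‖) {p q : V} (hp : p ∈ K) (hq : q ∈ K) :
    f q ≤ f p + C * ‖q - p‖ := by
  let γ : ℝ → V := fun t => p + t • (q - p)
  have hγK : ∀ t ∈ Icc (0 : ℝ) 1, γ t ∈ K := fun t ht => by
    have := hK hp hq (sub_nonneg.2 ht.2) ht.1 (by ring)
    convert this using 1
    simp only [γ]
    module
  have hγc : Continuous γ := by fun_prop
  have hfc : ∀ p ∈ K, ContinuousAt f p := by
    intro p hp
    rw [ContinuousAt, tendsto_iff_dist_tendsto_zero]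
    have h0 : Tendsto (fun q => C * ‖q - p‖) (𝓝 p) (𝓝 0) := by
      have : Continuous fun q => C * ‖q - p‖ := by fun_prop
      simpa using this.tendsto p
    refine squeeze_zero' (Eventually.of_forall fun _ => dist_nonneg) ?_ h0
    filter_upwards [hf p hp] with q hq
    rwa [Real.dist_eq]
  have key := image_le_of_liminf_slope_right_le_deriv_boundary (f := fun t => f (γ t))
    (a := 0) (b := 1) (B := fun t => f p + C * ‖q - p‖ * t) (B' := fun _ => C * ‖q - p‖)
    (fun t ht => ((hfc _ (hγK t ht)).comp hγc.continuousAt).continuousWithinAt)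
    (by simp [γ]) (by fun_prop)
    (fun t _ => by
      have := (((hasDerivAt_id t).const_mul (C * ‖q - p‖)).const_add (f p)).hasDerivWithinAt
        (s := Ici t)
      rwa [mul_one] at this) ?_ (show (1 : ℝ) ∈ Icc (0 : ℝ) 1 by simp)
  · simpa [γ] using key
  · intro t ht r hr
    refine Eventually.frequently ?_
    have h1 := hγc.continuousAt.eventually (hf _ (hγK t (Ico_subset_Icc_self ht)))
    filter_upwards [h1.filter_mono nhdsWithin_le_nhds, self_mem_nhdsWithin] with z hz hzt
    have hpos : 0 < z - t := sub_pos.2 hzt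
    have hγz : γ z - γ t = (z - t) • (q - p) := by
      simp only [γ]
      module
    rw [hγz, norm_smul, Real.norm_of_nonneg hpos.le] at hz
    rw [slope_def_field, div_lt_iff₀ hpos]
    calc f (γ z) - f (γ t) ≤ C * ((z - t) * ‖q - p‖) := (le_abs_self _).trans hz
      _ = C * ‖q - p‖ * (z - t) := by ring
      _ < r * (z - t) := mul_lt_mul_of_pos_right hr hpos

/-- Near a point where the derivative is bounded below, so is the increment. -/
theorem eventually_norm_le_of_fderiv {V W : Type*} [NormedAddCommGroup V] [NormedSpace ℝ V]
    [NormedAddCommGroup W] [NormedSpace ℝ W] {P : V → W} {w : V} (hP : DifferentiableAt ℝ P w)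
    {k : ℝ} (hk : 0 < k) (h : ∀ v, ‖v‖ ≤ k * ‖fderiv ℝ P w v‖) :
    ∀ᶠ w' in 𝓝 w, ‖w' - w‖ ≤ 2 * k * ‖P w' - P w‖ := by
  -- With the constant `1 / (2k)` the error absorbs only half of `‖w' - w‖`, whence the factor `2k`.
  have h1 := hP.hasFDerivAt.isLittleO.def (c := 1 / (2 * k)) (by positivity)
  filter_upwards [h1] with w' hw'
  have h2 := h (w' - w)
  have h3 : ‖fderiv ℝ P w (w' - w)‖ ≤ ‖P w' - P w‖ + 1 / (2 * k) * ‖w' - w‖ := by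
    have h4 : fderiv ℝ P w (w' - w) =
        (P w' - P w) - (P w' - P w - fderiv ℝ P w (w' - w)) := by abel
    rw [h4]
    exact (norm_sub_le _ _).trans (by linarith)
  have h5 : k * ‖fderiv ℝ P w (w' - w)‖ ≤ k * ‖P w' - P w‖ + 1 / 2 * ‖w' - w‖ := by
    calc k * ‖fderiv ℝ P w (w' - w)‖ ≤ k * (‖P w' - P w‖ + 1 / (2 * k) * ‖w' - w‖) :=
          mul_le_mul_of_nonneg_left h3 hk.le
      _ = _ := by field_simp
  linarith

/-- Lower bounds of injective linear maps persist under small perturbations. -/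
theorem exists_eventually_lower_bound {ι V W : Type*} [NormedAddCommGroup V] [NormedSpace ℝ V]
    [NormedAddCommGroup W] [NormedSpace ℝ W] [FiniteDimensional ℝ V] {l : Filter ι}
    {Φ : ι → V →L[ℝ] W} {L : V →L[ℝ] W} (hΦ : Tendsto Φ l (𝓝 L)) (hL : ∀ v, L v = 0 → v = 0) :
    ∃ k : ℝ, 0 < k ∧ ∀ᶠ i in l, ∀ v, ‖v‖ ≤ k * ‖Φ i v‖ := by
  have hker : LinearMap.ker L.toLinearMap = ⊥ := LinearMap.ker_eq_bot'.2 hL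
  obtain ⟨κ, hκ, hanti⟩ := LinearMap.exists_antilipschitzWith L.toLinearMap hker
  have hκ' : (0 : ℝ) < κ := hκ
  have h0 : ∀ v, ‖v‖ ≤ κ * ‖L v‖ := fun v => by
    have := hanti.le_mul_dist v 0
    simpa using this
  refine ⟨2 * κ, by positivity, ?_⟩
  have h1 : ∀ᶠ i in l, ‖Φ i - L‖ < 1 / (2 * κ) := by
    have := tendsto_iff_norm_sub_tendsto_zero.1 hΦ
    exact this.eventually_lt_const (by positivity)
  filter_upwards [h1] with i hi v
  have h2 : ‖L v‖ ≤ ‖Φ i v‖ + 1 / (2 * κ) * ‖v‖ := by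
    have h3 : L v = Φ i v - (Φ i - L) v := by simp
    rw [h3]
    refine (norm_sub_le _ _).trans (by gcongr; exact ((Φ i - L).le_opNorm v).trans (by gcongr))
  have h4 : κ * ‖L v‖ ≤ κ * ‖Φ i v‖ + 1 / 2 * ‖v‖ := by
    calc κ * ‖L v‖ ≤ κ * (‖Φ i v‖ + 1 / (2 * κ) * ‖v‖) := mul_le_mul_of_nonneg_left h2 hκ'.le
      _ = _ := by field_simp
  have := h0 v
  linarith

end Topology

/-! ### The differential of the cost at boundary points of `Λ`. -/

section Boundary

variable {n : ℕ} {M N : Type*}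
  [TopologicalSpace M] [ChartedSpace (Eu n) M] [IsManifold 𝓘(ℝ, Eu n) ∞ M]
  [TopologicalSpace N] [ChartedSpace (Eu n) N] [IsManifold 𝓘(ℝ, Eu n) ∞ N]
  {c : M → N → ℝ} {Ω : Set M} {Λ : Set N}

theorem tendsto_cost_right (hA0 : CostA0 (n := n) c Ω Λ) {x : M} (hx : x ∈ Ω) {y₀ : N}
    (hy₀ : y₀ ∈ closure Λ) : Tendsto (c x) (𝓝[Λ] y₀) (𝓝 (c x y₀)) := by
  refine (hA0.tendsto x (subset_closure hx) y₀ hy₀).comp (f := fun y => (x, y)) ?_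
  rw [nhdsWithin_prod_eq]
  exact (tendsto_const_nhds.mono_right le_rfl |> fun h =>
    tendsto_nhdsWithin_iff.2 ⟨h, Eventually.of_forall fun _ => hx⟩).prodMk tendsto_id

theorem tendsto_partialLeft (hA0 : CostA0 (n := n) c Ω Λ) {x : M} (hx : x ∈ closure Ω) {y₀ : N}
    (hy₀ : y₀ ∈ closure Λ) :
    ∃ l : Eu n →L[ℝ] ℝ, Tendsto
      (fun p : M × N => partialLeft (costInCharts (n := n) c x y₀)
        (extChartAt 𝓘(ℝ, Eu n) x p.1) (extChartAt 𝓘(ℝ, Eu n) y₀ p.2))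
      (𝓝[Ω ×ˢ Λ] (x, y₀)) (𝓝 l) := by
  obtain ⟨L, hL⟩ := hA0.tendsto_deriv x hx y₀ hy₀ 1 (by norm_num)
  have h1 := ((continuousMultilinearCurryFin1 ℝ (Eu n × Eu n) ℝ).continuous.tendsto L).comp hL
  let r : ((Eu n × Eu n) →L[ℝ] ℝ) →L[ℝ] (Eu n →L[ℝ] ℝ) :=
    (ContinuousLinearMap.compL ℝ (Eu n) (Eu n × Eu n) ℝ).flip (ContinuousLinearMap.inl ℝ _ _)
  have h2 := (r.continuous.tendsto _).comp h1
  refine ⟨_, h2.congr fun p => ?_⟩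
  ext v
  simp [r, partialLeft, iteratedFDeriv_one_apply]

/-- `∂ₓc(x, ·)` at a boundary point of `Λ` exists and is the limit of its values on `Λ`. -/
theorem tendsto_covec (hΩ : IsOpen Ω) (H : RegularCost n c Ω Λ) (hA0 : CostA0 (n := n) c Ω Λ)
    {x : M} (hx : x ∈ Ω) {y₀ : N} (hy₀ : y₀ ∈ closure Λ) :
    Tendsto (covec (n := n) c x) (𝓝[Λ] y₀) (𝓝 (covec c x y₀)) := by
  obtain ⟨l, hl⟩ := tendsto_partialLeft hA0 (subset_closure hx) hy₀
  rw [nhdsWithin_prod_eq, hΩ.nhdsWithin_eq hx] at hl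
  set C := costInCharts (n := n) c x y₀ with hC
  set χ := extChartAt 𝓘(ℝ, Eu n) x with hχ
  set κ := extChartAt 𝓘(ℝ, Eu n) y₀ with hκ
  have : NeBot (𝓝[Λ] y₀) := mem_closure_iff_nhdsWithin_neBot.1 hy₀
  have hys : ∀ᶠ y in 𝓝[Λ] y₀, y ∈ Λ ∧ y ∈ κ.source :=
    (eventually_mem_nhdsWithin).and
      (mem_nhdsWithin_of_mem_nhds (extChartAt_source_mem_nhds (I := 𝓘(ℝ, Eu n)) y₀))
  have hlim : Tendsto (covec (n := n) c x) (𝓝[Λ] y₀) (𝓝 l) := by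
    have h1 : Tendsto (fun y : N => (x, y)) (𝓝[Λ] y₀) (𝓝 x ×ˢ 𝓝[Λ] y₀) :=
      tendsto_const_nhds.prodMk tendsto_id
    refine (hl.comp h1).congr' ?_
    filter_upwards [hys] with y hy
    exact (H.covec_eq_partialLeft hx hy.1 hy.2).symm
  -- At a boundary point `covec` is the true differential of the extended cost, so differentiability
  -- of `c(·, y₀)` has to be proved. The mean value inequality holds for `y ∈ Λ`, uniformly near
  -- `y₀` since the limit of `∂ₓc` is joint in both variables; then `y → y₀`.
  suffices hder : HasFDerivAt (fun u : Eu n => c (χ.symm u) y₀) l (χ x) by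
    have : covec c x y₀ = l := by
      rw [covec, mfderiv_eq_fderiv_chart hder.differentiableAt, hder.fderiv]
    rwa [this]
  refine HasFDerivAt.of_isLittleO (Asymptotics.isLittleO_iff.2 fun ε hε => ?_)
  have h1 : ∀ᶠ p in 𝓝 x ×ˢ 𝓝[Λ] y₀, ‖partialLeft C (χ p.1) (κ p.2) - l‖ < ε :=
    (tendsto_iff_norm_sub_tendsto_zero.1 hl).eventually_lt_const hε
  obtain ⟨U, hU, V, hV, hUV⟩ := Filter.eventually_prod_iff.1 h1
  have h2 : ∀ᶠ u in 𝓝 (χ x), (u ∈ χ.target ∧ χ.symm u ∈ Ω) ∧ U (χ.symm u) := by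
    refine (RegularCost.eventually_chart_mem hΩ hx).and ?_
    have := continuousAt_extChartAt_symm (I := 𝓘(ℝ, Eu n)) x
    refine this.eventually ?_
    rw [extChartAt_to_inv]
    exact hU
  obtain ⟨r, hr, hball⟩ := Metric.eventually_nhds_iff_ball.1 h2
  filter_upwards [Metric.ball_mem_nhds (χ x) hr] with u hu
  have h3 : ∀ᶠ y in 𝓝[Λ] y₀, ‖c (χ.symm u) y - c (χ.symm (χ x)) y - l (u - χ x)‖ ≤
      ε * ‖u - χ x‖ := by
    filter_upwards [hys, hV] with y hy hVy
    have hd : ∀ w ∈ Metric.ball (χ x) r, ContDiffAt ℝ 4 C (w, κ y) := by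
      intro w hw
      have h4 := H.contDiffAt (x₀ := x) (y₀ := y₀) (hball w hw).1.2
        (χ.map_target (hball w hw).1.1) hy.1 hy.2
      rwa [← hχ, χ.right_inv (hball w hw).1.1] at h4
    have hfun : (fun u : Eu n => c (χ.symm u) y) = fun u => C (u, κ y) := by
      funext u
      simp only [hC, costInCharts, ← hκ, κ.left_inv hy.2, ← hχ]
    have hdf : ∀ w ∈ Metric.ball (χ x) r,
        DifferentiableAt ℝ (fun u : Eu n => c (χ.symm u) y) w := by
      intro w hw
      rw [hfun]
      exact ((hd w hw).differentiableAt (by norm_num)).comp w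
        (hasFDerivAt_prodMk_left (𝕜 := ℝ) w (κ y)).differentiableAt
    refine (convex_ball (χ x) r).norm_image_sub_le_of_norm_fderiv_le' hdf (fun w hw => ?_)
      (Metric.mem_ball_self hr) hu
    have h5 : fderiv ℝ (fun u : Eu n => c (χ.symm u) y) w = partialLeft C w (κ y) := by
      rw [hfun]
      exact ContinuousLinearMap.ext fun v =>
        fderiv_slice_left ((hd w hw).differentiableAt (by norm_num)) v
    rw [h5]
    have h6 := hUV (hball w hw).2 hVy
    simp only [χ.right_inv (hball w hw).1.1] at h6
    exact h6.le
  have hu1 := tendsto_cost_right hA0 (hball u hu).1.2 hy₀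
  have hu2 := tendsto_cost_right hA0 (hball (χ x) (Metric.mem_ball_self hr)).1.2 hy₀
  exact le_of_tendsto ((hu1.sub hu2).sub tendsto_const_nhds).norm h3

end Boundary

/-! ### Continuity of the inverse of `∂ₓc(x, ·)` up to the boundary. -/

section Boundary

variable {n : ℕ} {M N : Type*}
  [TopologicalSpace M] [ChartedSpace (Eu n) M] [IsManifold 𝓘(ℝ, Eu n) ∞ M]
  [TopologicalSpace N] [ChartedSpace (Eu n) N] [IsManifold 𝓘(ℝ, Eu n) ∞ N]
  {c : M → N → ℝ} {Ω : Set M} {Λ : Set N}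

/-- The distance to `y₀` in the chart centred at `y₀`, truncated and extended by a constant. -/
theorem exists_truncated_chart_dist [T2Space N] (y₀ : N) {r : ℝ} (hr : 0 < r)
    (hball : Metric.ball (extChartAt 𝓘(ℝ, Eu n) y₀ y₀) r ⊆ (extChartAt 𝓘(ℝ, Eu n) y₀).target) :
    ∃ θ : N → ℝ, Continuous θ ∧ θ y₀ = 0 ∧ (∀ U ∈ 𝓝 y₀, ∃ δ > 0, ∀ y, θ y < δ → y ∈ U) ∧
      (∀ y, (y ∈ (extChartAt 𝓘(ℝ, Eu n) y₀).source ∧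
          extChartAt 𝓘(ℝ, Eu n) y₀ y ∈ Metric.ball (extChartAt 𝓘(ℝ, Eu n) y₀ y₀) r) ∨
        ∀ᶠ y' in 𝓝 y, θ y' = θ y) ∧
      ∀ y ∈ (extChartAt 𝓘(ℝ, Eu n) y₀).source, ∀ y' ∈ (extChartAt 𝓘(ℝ, Eu n) y₀).source,
        |θ y - θ y'| ≤ ‖extChartAt 𝓘(ℝ, Eu n) y₀ y - extChartAt 𝓘(ℝ, Eu n) y₀ y'‖ := by
  classical
  set κ := extChartAt 𝓘(ℝ, Eu n) y₀ with hκ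
  have hopen : IsOpen κ.source := isOpen_extChartAt_source y₀
  have hcont : ContinuousOn κ κ.source := continuousOn_extChartAt y₀
  have hy₀ : y₀ ∈ κ.source := mem_extChartAt_source y₀
  let R := r / 2
  have hR : 0 < R := half_pos hr
  let θ : N → ℝ := fun y => if y ∈ κ.source then min ‖κ y - κ y₀‖ R else R
  have hθs : ∀ y ∈ κ.source, θ y = min ‖κ y - κ y₀‖ R := fun y hy => if_pos hy
  -- Compact, hence closed because `N` is Hausdorff; so the constant value outside `Q` glues
  -- continuously.
  let Q : Set N := κ.symm '' Metric.closedBall (κ y₀) R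
  have hsub : Metric.closedBall (κ y₀) R ⊆ κ.target :=
    (Metric.closedBall_subset_ball (half_lt_self hr)).trans hball
  have hQ : IsClosed Q := ((isCompact_closedBall (κ y₀) R).image_of_continuousOn
    ((continuousOn_extChartAt_symm y₀).mono hsub)).isClosed
  have hoff : ∀ y, y ∉ Q → θ y = R := by
    intro y hy
    by_cases hys : y ∈ κ.source
    · rw [hθs y hys]
      refine min_eq_right (le_of_not_gt fun hlt => hy ⟨κ y, ?_, κ.left_inv hys⟩)
      rw [Metric.mem_closedBall, dist_eq_norm]
      exact hlt.le
    · exact if_neg hys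
  have hoff' : ∀ y, y ∉ Q → ∀ᶠ y' in 𝓝 y, θ y' = θ y := by
    intro y hy
    filter_upwards [hQ.isOpen_compl.mem_nhds hy] with y' hy'
    rw [hoff y hy, hoff y' hy']
  have hQs : ∀ y ∈ Q, y ∈ κ.source ∧ κ y ∈ Metric.ball (κ y₀) r := by
    rintro _ ⟨w, hw, rfl⟩
    refine ⟨κ.map_target (hsub hw), ?_⟩
    rw [κ.right_inv (hsub hw)]
    exact Metric.closedBall_subset_ball (half_lt_self hr) hw
  refine ⟨θ, ?_, ?_, ?_, ?_, ?_⟩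
  · rw [continuous_iff_continuousAt]
    intro y
    by_cases hy : y ∈ Q
    · have hys := (hQs y hy).1
      have hc : ContinuousAt (fun y => min ‖κ y - κ y₀‖ R) y :=
        (((hcont.continuousAt (hopen.mem_nhds hys)).sub continuousAt_const).norm).min
          continuousAt_const
      refine hc.congr ?_
      filter_upwards [hopen.mem_nhds hys] with y' hy'
      exact (hθs y' hy').symm
    · exact continuousAt_const.congr ((hoff' y hy).mono fun y' h => h.symm)
  · rw [hθs y₀ hy₀]
    simp [hR.le]
  · intro U hU
    have h1 : Tendsto κ.symm (𝓝 (κ y₀)) (𝓝 y₀) := by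
      have := continuousAt_extChartAt_symm (I := 𝓘(ℝ, Eu n)) y₀
      rwa [ContinuousAt, extChartAt_to_inv] at this
    obtain ⟨ε, hε, hεU⟩ := Metric.mem_nhds_iff.1 (h1 hU)
    refine ⟨min ε R, lt_min hε hR, fun y hy => ?_⟩
    have hyQ : y ∈ Q := by
      by_contra hcon
      rw [hoff y hcon] at hy
      exact absurd (hy.trans_le (min_le_right _ _)) (lt_irrefl _)
    have hys := (hQs y hyQ).1
    rw [hθs y hys] at hy
    have h2 : ‖κ y - κ y₀‖ < ε := by
      rcases min_choice ‖κ y - κ y₀‖ R with h | h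
      · rw [h] at hy
        exact hy.trans_le (min_le_left _ _)
      · rw [h] at hy
        exact absurd (hy.trans_le (min_le_right _ _)) (lt_irrefl _)
    have h3 : κ y ∈ Metric.ball (κ y₀) ε := by rwa [Metric.mem_ball, dist_eq_norm]
    have h4 := hεU h3
    rwa [mem_preimage, κ.left_inv hys] at h4
  · intro y
    by_cases hy : y ∈ Q
    · exact Or.inl (hQs y hy)
    · exact Or.inr (hoff' y hy)
  · intro y hy y' hy'
    rw [hθs y hy, hθs y' hy']
    refine (abs_min_sub_min_le_max _ _ _ _).trans ?_
    rw [sub_self, abs_zero]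
    refine max_le ((abs_norm_sub_norm_le _ _).trans ?_) (norm_nonneg _)
    rw [sub_sub_sub_cancel_right]

/-- The limit matrix of A2 at `(x, y₀)` is invertible, so the mixed Hessians at nearby points of `Λ`
are invertible with a uniform bound. -/
theorem exists_fderiv_lower_bound (H : RegularCost n c Ω Λ) (hA2 : CostA2 (n := n) c Ω Λ) {x : M}
    (hx : x ∈ Ω) {y₀ : N} (hy₀ : y₀ ∈ closure Λ) :
    ∃ k : ℝ, 0 < k ∧ ∃ r : ℝ, 0 < r ∧
      Metric.ball (extChartAt 𝓘(ℝ, Eu n) y₀ y₀) r ⊆ (extChartAt 𝓘(ℝ, Eu n) y₀).target ∧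
      ∀ y ∈ Λ, y ∈ (extChartAt 𝓘(ℝ, Eu n) y₀).source →
        extChartAt 𝓘(ℝ, Eu n) y₀ y ∈ Metric.ball (extChartAt 𝓘(ℝ, Eu n) y₀ y₀) r →
        ∀ v, ‖v‖ ≤ k * ‖fderiv ℝ (partialLeft (costInCharts (n := n) c x y₀)
          (extChartAt 𝓘(ℝ, Eu n) x x)) (extChartAt 𝓘(ℝ, Eu n) y₀ y) v‖ := by
  obtain ⟨A, hA, hlim⟩ := hA2 x (subset_closure hx) y₀ hy₀
  set κ := extChartAt 𝓘(ℝ, Eu n) y₀ with hκ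
  have hincl : Tendsto (fun y : N => (x, y)) (𝓝[Λ] y₀) (𝓝[Ω ×ˢ Λ] (x, y₀)) := by
    rw [nhdsWithin_prod_eq, H.isOpen_left.nhdsWithin_eq hx]
    exact tendsto_const_nhds.prodMk tendsto_id
  have h1 := (continuous_matrixForm.tendsto A).comp (hlim.comp hincl)
  obtain ⟨k, hk, hev⟩ := exists_eventually_lower_bound h1
    (fun w hw => eq_zero_of_matrixForm_right hA fun v => by rw [hw]; rfl)
  rw [eventually_nhdsWithin_iff] at hev
  have h2 : ∀ᶠ w in 𝓝 (κ y₀), w ∈ κ.target ∧ (κ.symm w ∈ Λ →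
      ∀ v, ‖v‖ ≤ k * ‖matrixForm (mixedHess (n := n) c x y₀ x (κ.symm w)) v‖) := by
    refine Eventually.and (extChartAt_target_mem_nhds y₀) ?_
    have h3 := (continuousAt_extChartAt_symm (I := 𝓘(ℝ, Eu n)) y₀).tendsto
    rw [extChartAt_to_inv] at h3
    exact h3.eventually hev
  obtain ⟨r, hr, hball⟩ := Metric.eventually_nhds_iff_ball.1 h2
  refine ⟨k, hk, r, hr, fun w hw => (hball w hw).1, fun y hy hys hyb => ?_⟩
  have h3 := (hball _ hyb).2
  rw [κ.left_inv hys] at h3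
  rw [fderiv_partialLeft_eq_matrixForm (H.contDiffAt hx (mem_extChartAt_source x) hy hys)]
  exact h3 hy

/-- The inverse of `y ↦ ∂ₓc(x, y)` on the closure of `Λ` is continuous. -/
theorem comap_covec_inf_le_nhds [T2Space N] (H : RegularCost n c Ω Λ)
    (hA0 : CostA0 (n := n) c Ω Λ) (hA2 : CostA2 (n := n) c Ω Λ)
    {x : M} (hx : x ∈ Ω) {y₀ : N} (hy₀ : y₀ ∈ closure Λ) :
    comap (covec (n := n) c x) (𝓝 (covec c x y₀)) ⊓ 𝓟 (closure Λ) ≤ 𝓝 y₀ := by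
  obtain ⟨k, hk, r, hr, hball, hlow⟩ := exists_fderiv_lower_bound H hA2 hx hy₀
  obtain ⟨θ, hθ, hθ0, hθU, hθloc, hθlip⟩ := exists_truncated_chart_dist y₀ hr hball
  set κ := extChartAt 𝓘(ℝ, Eu n) y₀ with hκ
  have hF : ContinuousOn (covec (n := n) c x) (closure Λ) :=
    continuousOn_closure_of_tendsto fun y hy => tendsto_covec H.isOpen_left H hA0 hx hy
  have : Nonempty N := ⟨y₀⟩
  let E : (Eu n →L[ℝ] ℝ) → N := Function.invFunOn (fun y => covec (n := n) c x y) Λ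
  have hE : ∀ y ∈ Λ, E (covec c x y) = y := fun y hy =>
    (H.injOn_right x hx).leftInvOn_invFunOn hy
  -- The distance to `y₀`, as a function of `p`, is locally `2k`-Lipschitz on the image of `Λ`. That
  -- image is convex, so the estimate becomes global and no point can stay away from `y₀` while its
  -- covector approaches that of `y₀`.
  have hlocal : ∀ p ∈ (fun y => covec (n := n) c x y) '' Λ,
      ∀ᶠ q in 𝓝 p, |θ (E q) - θ (E p)| ≤ 2 * k * ‖q - p‖ := by
    rintro _ ⟨y, hy, rfl⟩
    simp only
    obtain ⟨e, he, he0, -, hev⟩ := H.exists_local_inverse hx hy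
    have hEe := RegularCost.eventuallyEq_chart_of_rightInverse hE (hev.mono fun p hp => ⟨hp.1.2, hp.2.2⟩)
    have hEc : Tendsto E (𝓝 (covec c x y)) (𝓝 y) := by
      refine Tendsto.congr' hEe.symm ?_
      have h1 := continuousAt_extChartAt_symm (I := 𝓘(ℝ, Eu n)) y
      rw [ContinuousAt, extChartAt_to_inv, ← he0] at h1
      exact h1.comp he.continuousAt
    have hEΛ : ∀ᶠ q in 𝓝 (covec c x y), E q ∈ Λ ∧ covec c x (E q) = q := by
      filter_upwards [hev, hEe] with q hq hq'
      rw [hq']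
      exact ⟨hq.1.2, hq.2.2⟩
    rw [hE y hy]
    -- Inside the chart ball the bound on the mixed Hessian applies; elsewhere `θ` is locally
    -- constant. The truncation is what makes a bound near `y₀` enough.
    rcases hθloc y with ⟨hys, hyb⟩ | hconst
    · have hd : DifferentiableAt ℝ (partialLeft (costInCharts (n := n) c x y₀)
          (extChartAt 𝓘(ℝ, Eu n) x x)) (κ y) :=
        (contDiffAt_partialLeft (H.contDiffAt hx (mem_extChartAt_source x) hy hys)).differentiableAt
          (by norm_num)
      have h2 := eventually_norm_le_of_fderiv hd hk (hlow y hy hys hyb)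
      have h3 : Tendsto (fun q => κ (E q)) (𝓝 (covec c x y)) (𝓝 (κ y)) :=
        (continuousAt_extChartAt' (I := 𝓘(ℝ, Eu n)) hys).tendsto.comp hEc
      filter_upwards [h3.eventually h2, hEΛ,
        hEc.eventually ((isOpen_extChartAt_source (I := 𝓘(ℝ, Eu n)) y₀).mem_nhds hys)]
        with q h4 h5 h6
      rw [← H.covec_eq_partialLeft hx hy hys, ← H.covec_eq_partialLeft hx h5.1 h6, h5.2] at h4
      exact (hθlip _ h6 _ hys).trans h4
    · filter_upwards [hEc.eventually hconst] with q hq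
      rw [hq, sub_self, abs_zero]
      positivity
  have hΛ1 : ∀ y ∈ Λ, ∀ y' ∈ Λ, θ y ≤ θ y' + 2 * k * ‖covec (n := n) c x y - covec c x y'‖ := by
    intro y hy y' hy'
    have := le_add_mul_norm_of_local (H.convex_right x hx) hlocal (mem_image_of_mem _ hy')
      (mem_image_of_mem _ hy)
    simpa only [hE y hy, hE y' hy'] using this
  have hF' : ∀ y ∈ closure Λ, ContinuousWithinAt (covec (n := n) c x) Λ y := fun y hy =>
    (hF y hy).mono subset_closure
  -- The estimate between two points of `Λ` passes to the closure one point at a time, using only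
  -- continuity of `θ` and of `covec`.
  have hΛ2 : ∀ y ∈ Λ, θ y ≤ 2 * k * ‖covec (n := n) c x y - covec c x y₀‖ := by
    intro y hy
    have := ContinuousWithinAt.closure_le hy₀ continuousWithinAt_const
      (hθ.continuousWithinAt.add (((continuousWithinAt_const.sub (hF' y₀ hy₀)).norm).const_mul
        (2 * k))) (hΛ1 y hy)
    simpa [hθ0] using this
  have hΛ3 : ∀ y ∈ closure Λ, θ y ≤ 2 * k * ‖covec (n := n) c x y - covec c x y₀‖ :=
    fun y hy => ContinuousWithinAt.closure_le hy hθ.continuousWithinAt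
      ((((hF' y hy).sub continuousWithinAt_const).norm).const_mul (2 * k)) hΛ2
  intro U hU
  obtain ⟨δ, hδ, hδU⟩ := hθU U hU
  refine mem_inf_iff_superset.2 ⟨covec c x ⁻¹' Metric.ball (covec c x y₀) (δ / (2 * k)),
    preimage_mem_comap (Metric.ball_mem_nhds _ (by positivity)), closure Λ, mem_principal_self _, ?_⟩
  rintro y ⟨hy1, hy2⟩
  refine hδU y ((hΛ3 y hy2).trans_lt ?_)
  rw [mem_preimage, Metric.mem_ball, dist_eq_norm, lt_div_iff₀ (by positivity)] at hy1
  linarith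

/-- Quasiconvexity persists on the part of the closure where the function is continuous. -/
theorem quasiconvexOn_of_dense {V : Type*} [NormedAddCommGroup V] [NormedSpace ℝ V] {K L : Set V}
    {f : V → ℝ} (hf : QuasiconvexOn ℝ K f) (hKL : K ⊆ L) (hLK : L ⊆ closure K)
    (hL : Convex ℝ L) (hc : ContinuousOn f L) : QuasiconvexOn ℝ L f := by
  rw [quasiconvexOn_iff_le_max] at hf ⊢
  refine ⟨hL, fun p hp q hq a b ha hb hab => ?_⟩
  have : NeBot (𝓝[K] p) := mem_closure_iff_nhdsWithin_neBot.1 (hLK hp)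
  have : NeBot (𝓝[K] q) := mem_closure_iff_nhdsWithin_neBot.1 (hLK hq)
  have hcK : ∀ r ∈ L, Tendsto f (𝓝[K] r) (𝓝 (f r)) := fun r hr => (hc r hr).mono hKL
  have hmem : ∀ᶠ z in 𝓝[K] p ×ˢ 𝓝[K] q, z.1 ∈ K ∧ z.2 ∈ K :=
    (eventually_mem_nhdsWithin (a := p) (s := K)).prod_mk
      (eventually_mem_nhdsWithin (a := q) (s := K))
  have h1 : Tendsto (fun z : V × V => a • z.1 + b • z.2) (𝓝[K] p ×ˢ 𝓝[K] q)
      (𝓝[K] (a • p + b • q)) := by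
    refine tendsto_nhdsWithin_iff.2 ⟨?_, hmem.mono fun z hz => hf.1 hz.1 hz.2 ha hb hab⟩
    exact ((tendsto_fst.mono_right nhdsWithin_le_nhds).const_smul a).add
      ((tendsto_snd.mono_right nhdsWithin_le_nhds).const_smul b)
  exact le_of_tendsto_of_tendsto ((hcK _ (hL hp hq ha hb hab)).comp h1)
    (((hcK p hp).comp tendsto_fst).max ((hcK q hq).comp tendsto_snd))
    (hmem.mono fun z hz => hf.2 hz.1 hz.2 ha hb hab)

end Boundary

/-! ### Convexity and connectedness of the contact set. -/

theorem corollary3p2 {n : ℕ} {M N : Type*}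
    [TopologicalSpace M] [T2Space M] [ChartedSpace (Eu n) M] [IsManifold 𝓘(ℝ, Eu n) ∞ M]
    [TopologicalSpace N] [T2Space N] [ChartedSpace (Eu n) N] [IsManifold 𝓘(ℝ, Eu n) ∞ N]
    (g : RiemMetric n M) (h : RiemMetric n N)
    (Ω : Set M) (hΩ : IsOpen Ω) (hΩ' : IsConnected Ω)
    (Λ : Set N) (hΛ : IsOpen Λ) (hΛ' : IsConnected Λ)
    (c : M → N → ℝ)
    (hA0 : CostA0 (n := n) c Ω Λ) (hA1 : CostA1 g h c Ω Λ) (hA2 : CostA2 (n := n) c Ω Λ)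
    (hcΛ : ∀ x ∈ Ω, IsCConvexAt g c Λ x)
    (hcΩ : ∀ y ∈ Λ, IsCConvexAt h (fun y x => c x y) Ω y)
    (hA3W : CostA3W g c Ω Λ)
    (φ : M → ℝ) (hφ : IsCConvexFunction c Ω Λ φ) (x : M) (hx : x ∈ Ω)
    -- only if the contact set reaches the boundary of `Λ`: also `Λ̄` is `c`-convex at `x`
    (hcl : ¬ contactSet c Ω Λ φ x ⊆ Λ → IsCConvexAt g c (closure Λ) x) :
    IsCConvexAt g c (contactSet c Ω Λ φ x) x ∧ IsConnected (contactSet c Ω Λ φ x) := by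
  have H := regularCost_of_hypotheses g h hΩ hΛ hA0 hA1 hA2 hcΛ hcΩ
  have hX : ∀ a ∈ Ω, ∀ b ∈ Λ, CrossConcaveAt (n := n) c a b := fun a ha b hb =>
    crossConcaveAt_of_A3W g H hA3W ha hb
  set F : N → (Eu n →L[ℝ] ℝ) := covec (n := n) c x with hFdef
  set G := contactSet c Ω Λ φ x with hG
  have hGcl : G ⊆ closure Λ := fun y hy => ((mem_contactSet_iff hx).1 hy).1
  have hinj : InjOn F (closure Λ) := fun y₁ h₁ y₂ h₂ heq =>
    hA1.1 x hx h₁ h₂ ((negGradCoord_eq_iff g c x y₁ y₂).2 heq)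
  have hF : ContinuousOn F (closure Λ) :=
    continuousOn_closure_of_tendsto fun y hy => tendsto_covec H.isOpen_left H hA0 hx hy
  have : Nonempty N := ⟨hΛ'.nonempty.some⟩
  let E : (Eu n →L[ℝ] ℝ) → N := Function.invFunOn F (closure Λ)
  have hE : ∀ y ∈ closure Λ, E (F y) = y := fun y hy => hinj.leftInvOn_invFunOn hy
  have hEc : ContinuousOn E (F '' closure Λ) := by
    rintro _ ⟨y, hy, rfl⟩
    rw [ContinuousWithinAt, hE y hy]
    have hle := comap_covec_inf_le_nhds H hA0 hA2 hx hy
    refine Tendsto.mono_right ?_ hle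
    refine tendsto_inf.2 ⟨tendsto_comap_iff.2 ?_, tendsto_principal.2 ?_⟩
    · refine Tendsto.congr' ?_ (tendsto_id.mono_left nhdsWithin_le_nhds)
      filter_upwards [self_mem_nhdsWithin] with p hp
      obtain ⟨y', hy', rfl⟩ := hp
      exact (congrArg F (hE y' hy')).symm
    · filter_upwards [self_mem_nhdsWithin] with p hp
      obtain ⟨y', hy', rfl⟩ := hp
      rwa [hE y' hy']
  have hquasi : ∀ z ∈ Ω, QuasiconvexOn ℝ (F '' Λ) fun p => c x (E p) - c z (E p) := fun z hz =>
    H.quasiconvexOn_sub hX hx hz fun y hy => hE y (subset_closure hy)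
  have hquasi' : Convex ℝ (F '' closure Λ) →
      ∀ z ∈ Ω, QuasiconvexOn ℝ (F '' closure Λ) fun p => c x (E p) - c z (E p) := by
    intro hconv z hz
    have hcc : ∀ a ∈ Ω, ContinuousOn (c a) (closure Λ) := fun a ha =>
      continuousOn_closure_of_tendsto fun y hy => tendsto_cost_right hA0 ha hy
    have hmaps : MapsTo E (F '' closure Λ) (closure Λ) := by
      rintro _ ⟨y, hy, rfl⟩
      rwa [hE y hy]
    exact quasiconvexOn_of_dense (hquasi z hz) (image_mono subset_closure) hF.image_closure hconv
      (((hcc x hx).comp hEc hmaps).sub ((hcc z hz).comp hEc hmaps))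
  -- `S` is the domain on which the maximum principle is applied: `Λ` if it contains the contact
  -- set, otherwise `Λ̄`, whose image is then convex by hypothesis.
  obtain ⟨S, hGS, hScl, hS⟩ : ∃ S : Set N, G ⊆ S ∧ S ⊆ closure Λ ∧
      ∀ z ∈ Ω, QuasiconvexOn ℝ (F '' S) fun p => c x (E p) - c z (E p) := by
    by_cases hsub : G ⊆ Λ
    · exact ⟨Λ, hsub, subset_closure, hquasi⟩
    · exact ⟨closure Λ, hGcl, Subset.rfl,
        hquasi' ((isCConvexAt_iff_convex_covec g c (closure Λ) x).1 (hcl hsub))⟩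
  have himage : F '' G = F '' S ∩ ⋂ z ∈ Ω, {p ∈ F '' S | c x (E p) - c z (E p) ≤ φ z - φ x} := by
    ext p
    simp only [mem_inter_iff, mem_iInter, mem_sep_iff]
    constructor
    · rintro ⟨y, hy, rfl⟩
      have hyS := mem_image_of_mem F (hGS hy)
      refine ⟨hyS, fun z hz => ⟨hyS, ?_⟩⟩
      rw [hE y (hGcl hy)]
      exact ((mem_contactSet_iff hx).1 hy).2 z hz
    · rintro ⟨⟨y, hy, rfl⟩, hall⟩
      refine ⟨y, (mem_contactSet_iff hx).2 ⟨hScl hy, fun z hz => ?_⟩, rfl⟩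
      have := (hall z hz).2
      rwa [hE y (hScl hy)] at this
  have hconvG : Convex ℝ (F '' G) := by
    rw [himage]
    exact (hS x hx).convex.inter (convex_iInter₂ fun z hz => hS z hz _)
  refine ⟨(isCConvexAt_iff_convex_covec g c G x).2 hconvG, ?_⟩
  have hne : G.Nonempty := contactSet_nonempty hφ hx
  have hEG : E '' (F '' G) = G := by
    rw [image_image]
    exact (image_congr fun y hy => hE y (hGcl hy)).trans (image_id' G)
  -- The contact set is the image of its convex coordinate image under the continuous inverse `E`.
  rw [← hEG]
  exact (hconvG.isConnected (hne.image F)).image E (hEc.mono (image_mono hGcl))
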